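/- Let $K$ be a field of characteristic $0$ (for instance a field of rational functions, so that the $x_i,y_i$ below may be independent formal variables). Let $\mathcal M=K[a_{-1},a_{-2},\dots]\,|0\rangle$ be the Fock space of the Heisenberg algebra $[a_m,a_n]=m\,\delta_{m,-n}$: for $n>0$, $a_{-n}$ acts by multiplication and $a_n=n\,\partial/\partial a_{-n}$. Let $\langle 0|$ be the linear form on $\mathcal M$ with $\langle 0|0\rangle=1$ and $\langle 0|a_{-n}=0$ for $n>0$. Define operators $U_n,U^*_n$ ($n\in\mathbb Z$) on $\mathcal M$ by $$U(z)=(1+z)\exp\Big(\sum_{n\ge1}\frac{a_{-n}}{n}z^n\Big)\exp\Big(-\sum_{n\ge1}\frac{a_n}{n}(z^n+z^{-n})\Big)=\sum_{n\in\mathbb Z}U_nz^{-n},$$ $$U^*(z)=(1-z)\exp\Big(-\sum_{n\ge1}\frac{a_{-n}}{n}z^n\Big)\exp\Big(\sum_{n\ge1}\frac{a_n}{n}(z^n+z^{-n})\Big)=\sum_{n\in\mathbb Z}U^*_nz^{n}.$$ A generalized partition with $l$ entries is a sequence of integers $\mu_1\ge\dots\ge\mu_l\ge0$. For generalized partitions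 $\lambda=(\lambda_1,\dots,\lambda_m)$ and $\mu=(\mu_1,\dots,\mu_l)$ put $$|\lambda^{so}\rangle=U_{-\lambda_1}\cdots U_{-\lambda_m}|0\rangle,\qquad \langle\mu^{so}|=\langle0|U^*_{-\mu_l}\cdots U^*_{-\mu_1}.$$ For $x=(x_1,\dots,x_N)$ with all $x_i\in K$ nonzero put $$\Gamma_+(x^\pm)=\prod_{i=1}^N\Gamma_+(x_i)\Gamma_+(x_i^{-1}),\qquad \Gamma_+(u)=\exp\Big(\sum_{n\ge1}\frac{a_n}{n}u^n\Big),$$ and define $h_n(x^\pm)$ by $\prod_{i=1}^N\frac1{(1-x_iz)(1-x_i^{-1}z)}=\sum_{n\ge0}h_n(x^\pm)z^n$, with $h_n(x^\pm)=0$ for $n<0$. For $l,N\ge 0$ and generalized partitions $\mu=(\mu_1,\dots,\mu_l)$ and $\lambda=(\lambda_1,\dots,\lambda_{l+N})$, the skew odd orthogonal character is defined as $$so_{\lambda/\mu}(x^\pm)=\langle\mu^{so}|\Gamma_+(x^\pm)|\lambda^{so}\rangle .$$ For a generalized partition $\nu=(\nu_1,\dots,\nu_M)$ and $x=(x_1,\dots,x_M)$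 with chosen square roots $x_i^{1/2}\in K$, the odd orthogonal character is given by the Weyl formula $$so_\nu(x^\pm)=\frac{\det\big(x_i^{\nu_j+M-j+\frac12}-x_i^{-(\nu_j+M-j+\frac12)}\big)_{i,j=1}^M}{\det\big(x_i^{M-j+\frac12}-x_i^{-(M-j+\frac12)}\big)_{i,j=1}^M}$$ whenever the denominator is nonzero. Then the following hold. 1. (Jacobi–Trudi identity) For all nonzero $x_1,\dots,x_N$, $so_{\lambda/\mu}(x^\pm)=\det(a_{ij})_{1\le i,j\le l+N}$, where $$a_{ij}=\begin{cases}h_{\lambda_i-\mu_j-i+j}(x^\pm)&1\le j\le l,\\ h_{\lambda_i-i+j}(x^\pm)+h_{\lambda_i-i-j+2l+1}(x^\pm)&l+1\le j\le l+N.\end{cases}$$ 2. For every $M\ge 0$, every generalized partition $\nu$ with $M$ entries and all nonzero $x_1,\dots,x_M$ having square roots in $K$ for which the denominator of the Weyl formula is nonzero, $so_\nu(x^\pm)=\langle0|\Gamma_+(x^\pm)|\nu^{so}\rangle$. 3. (Branching rule) Let $y=(y_1,\dots,y_l)$ and $x=(x_1,\dots,x_N)$ have nonzero entries, and let $\Gamma_+(y^\pm;x^\pm)$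 be the operator of the combined alphabet $(y_1,\dots,y_l,x_1,\dots,x_N)$. For each $\lambda=(\lambda_1,\dots,\lambda_{l+N})$ only finitely many $\mu=(\mu_1,\dots,\mu_l)$ satisfy $so_{\lambda/\mu}(x^\pm)\ne0$, and $$\langle0|\Gamma_+(y^\pm;x^\pm)|\lambda^{so}\rangle=\sum_{\mu=(\mu_1,\dots,\mu_l)}\langle0|\Gamma_+(y^\pm)|\mu^{so}\rangle\, so_{\lambda/\mu}(x^\pm).$$ If moreover the $y_i$ and $x_i$ have square roots in $K$ and the denominator of the Weyl formula for the combined alphabet is nonzero, then $$so_\lambda(y^\pm;x^\pm)=\sum_{\mu=(\mu_1,\dots,\mu_l)}so_\mu(y^\pm)\,so_{\lambda/\mu}(x^\pm).$$ -/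

import Mathlib

open scoped Nat LaurentPolynomial PowerSeries LaurentSeries

noncomputable section

namespace OddOrth

/-! ### Fock space and the Heisenberg algebra -/

/-- The Fock space over a ring of scalars `A`: polynomials in the commuting creation operators
`a_{-1}, a_{-2}, …` applied to the vacuum.  The variable `X n` is `a_{-n} |0⟩`, and the vacuum
vector `|0⟩` is `1`. -/
abbrev Fock (A : Type*) [CommRing A] := MvPolynomial ℕ+ A

section Heisenberg

variable {A : Type*} [CommRing A]

/-- The creation operator `a_{-n}`, `n > 0`. -/
def create (n : ℕ+) : Module.End A (Fock A) := LinearMap.mulLeft A (MvPolynomial.X n)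

/-- The annihilation operator `a_n = n ∂/∂a_{-n}`, `n > 0`. -/
def annih (n : ℕ+) : Module.End A (Fock A) :=
  ((n : ℕ) : A) • (MvPolynomial.pderiv n).toLinearMap

/-- The dual vacuum `⟨0|`, the linear form with `⟨0|0⟩ = 1` and `⟨0| a_{-n} = 0` for `n > 0`. -/
def vacuumDual : Fock A →ₗ[A] A := MvPolynomial.lcoeff A 0

/-- The Heisenberg relation `[a_m, a_{-n}] = m δ_{m,n}`. -/
theorem annih_create (m n : ℕ+) :
    annih m * create n - create n * annih m
      = (if m = n then ((m : ℕ) : A) else 0) • (1 : Module.End A (Fock A)) := by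
  refine LinearMap.ext fun v => ?_
  by_cases h : m = n
  · subst h
    simp [annih, create, MvPolynomial.smul_eq_C_mul]
  · simp [annih, create, h, MvPolynomial.pderiv_X_of_ne (Ne.symm h)]

variable [Algebra ℚ A]

theorem annih_support_finite (c : ℕ+ → A) (v : Fock A) :
    (Function.support fun n : ℕ+ => ((n : ℕ) : ℚ)⁻¹ • c n • annih n v).Finite := by
  refine v.vars.finite_toSet.subset fun n hn => ?_
  by_contra h
  exact hn (by simp [annih, MvPolynomial.pderiv_eq_zero_of_notMem_vars h])

/-- The operator `∑_{n ≥ 1} c_n a_n / n`; on every vector only finitely many terms are nonzero. -/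
def annihSum (c : ℕ+ → A) : Module.End A (Fock A) where
  toFun v := ∑ᶠ n : ℕ+, ((n : ℕ) : ℚ)⁻¹ • c n • annih n v
  map_add' v w := by
    rw [← finsum_add_distrib (annih_support_finite c v) (annih_support_finite c w)]
    simp
  map_smul' r v := by
    rw [RingHom.id_apply, smul_finsum' _ (annih_support_finite c v)]
    refine finsum_congr fun n => ?_
    rw [map_smul, smul_comm (c n) r, smul_comm _ r]

theorem annihSum_C (c : ℕ+ → A) (r : A) : annihSum c (MvPolynomial.C r) = 0 := by
  simp [annihSum, annih]

theorem annihSum_mul_X (c : ℕ+ → A) (v : Fock A) (m : ℕ+) :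
    annihSum c (v * MvPolynomial.X m) = annihSum c v * MvPolynomial.X m + c m • v := by
  have h1 : annihSum c v * MvPolynomial.X m
      = ∑ᶠ n : ℕ+, (((n : ℕ) : ℚ)⁻¹ • c n • annih n v) * MvPolynomial.X m :=
    finsum_mul' _ _ (annih_support_finite c v)
  have h2 : c m • v = ∑ᶠ n : ℕ+, if n = m then c m • v else 0 := by
    rw [finsum_eq_single _ m (fun n hn => by simp [hn])]
    simp
  rw [h1, h2, ← finsum_add_distrib]
  · refine finsum_congr fun n => ?_
    by_cases h : n = m
    · subst h
      have hq : ((n : ℕ) : ℚ)⁻¹ • ((n : ℕ) : A) = 1 := by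
        have : ((n : ℕ) : A) = ((n : ℕ) : ℚ) • (1 : A) := by simp [Algebra.smul_def]
        rw [this, smul_smul, inv_mul_cancel₀ (by exact_mod_cast n.ne_zero), one_smul]
      have key : ((n : ℕ) : ℚ)⁻¹ • c n • ((n : ℕ) : A) • v = c n • v := by
        rw [smul_comm, ← smul_assoc (((n : ℕ) : ℚ)⁻¹), hq, one_smul]
      simp only [annih, LinearMap.smul_apply, Derivation.coeFn_coe,
        Derivation.leibniz, MvPolynomial.pderiv_X_self, smul_add, smul_eq_mul, mul_one, if_true,
        key]
      rw [add_comm, mul_comm (MvPolynomial.X n)]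
      simp only [smul_mul_assoc]
    · simp only [annih, LinearMap.smul_apply, Derivation.coeFn_coe,
        Derivation.leibniz, MvPolynomial.pderiv_X_of_ne (Ne.symm h), if_neg h,
        mul_zero, zero_add, add_zero, smul_eq_mul, mul_comm (MvPolynomial.X m), smul_mul_assoc]
  · refine (annih_support_finite c v).subset fun n hn h => hn ?_
    simp only [h, zero_mul]
  · refine (Set.finite_singleton m).subset fun n hn => ?_
    by_contra h
    exact hn (if_neg h)

theorem annihSum_locally_nilpotent (c : ℕ+ → A) (v : Fock A) :
    ∃ m, ∀ k, m ≤ k → (annihSum c ^ k) v = 0 := by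
  induction v using MvPolynomial.induction_on with
  | C r =>
    refine ⟨1, fun k hk => ?_⟩
    obtain ⟨j, rfl⟩ := Nat.exists_eq_add_of_le' hk
    rw [pow_succ, Module.End.mul_apply, annihSum_C, map_zero]
  | add p q hp hq =>
    obtain ⟨m, hm⟩ := hp
    obtain ⟨m', hm'⟩ := hq
    refine ⟨max m m', fun k hk => ?_⟩
    rw [map_add, hm k (le_trans (le_max_left _ _) hk), hm' k (le_trans (le_max_right _ _) hk),
      add_zero]
  | mul_X p n hp =>
    have h : ∀ k : ℕ, (annihSum c ^ (k + 1)) (p * MvPolynomial.X n)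
        = (annihSum c ^ (k + 1)) p * MvPolynomial.X n
          + ((k + 1 : ℕ) : A) • c n • (annihSum c ^ k) p := by
      intro k
      induction k with
      | zero => simp [annihSum_mul_X]
      | succ k ih =>
        rw [pow_succ', Module.End.mul_apply, ih, map_add, annihSum_mul_X, map_smul, map_smul,
          ← Module.End.mul_apply, ← pow_succ', add_assoc]
        congr 1
        rw [← Module.End.mul_apply, ← pow_succ']
        push_cast
        rw [add_smul (_ + 1 : A) 1, one_smul, add_comm]
    obtain ⟨m, hm⟩ := hp
    refine ⟨m + 1, fun k hk => ?_⟩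
    obtain ⟨j, rfl⟩ := Nat.exists_eq_add_of_le' (le_trans (Nat.le_add_left 1 m) hk)
    rw [h, hm _ (by omega), hm _ (by omega), zero_mul, smul_zero, smul_zero, add_zero]

theorem expAnnih_support_finite (c : ℕ+ → A) (v : Fock A) :
    (Function.support fun k : ℕ => ((k ! : ℕ) : ℚ)⁻¹ • (annihSum c ^ k) v).Finite := by
  obtain ⟨m, hm⟩ := annihSum_locally_nilpotent c v
  refine (Set.finite_lt_nat m).subset fun k hk => ?_
  by_contra h
  exact hk (by simp [hm k (not_lt.mp h)])

/-- The operator `exp (∑_{n ≥ 1} c_n a_n / n)`, given by its exponential series; on every vector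
only finitely many terms are nonzero. -/
def expAnnih (c : ℕ+ → A) : Module.End A (Fock A) where
  toFun v := ∑ᶠ k : ℕ, ((k ! : ℕ) : ℚ)⁻¹ • (annihSum c ^ k) v
  map_add' v w := by
    rw [← finsum_add_distrib (expAnnih_support_finite c v) (expAnnih_support_finite c w)]
    simp
  map_smul' r v := by
    rw [RingHom.id_apply, smul_finsum' _ (expAnnih_support_finite c v)]
    refine finsum_congr fun n => ?_
    rw [map_smul, smul_comm _ r]

end Heisenberg

section Operators

variable {K : Type*} [Field K] [CharZero K]

/-! ### The vertex operators `U(z)` and `U^*(z)`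

For a vector `v`, the series `U(z) v` and `U^*(z) v` are Laurent series in `z` with coefficients
in the Fock space. -/

/-- The variable `z`, as a unit of the ring of Laurent series with coefficients in Fock space. -/
def zUnit : ((Fock K)⸨X⸩)ˣ where
  val := HahnSeries.single 1 1
  inv := HahnSeries.single (-1) 1
  val_inv := by simp [HahnSeries.single_mul_single]
  inv_val := by simp [HahnSeries.single_mul_single]

/-- Regard a Fock space vector whose scalars are Laurent polynomials in `z` as a Laurent series
in `z` with coefficients in Fock space. -/
def toSeries : Fock K[T;T⁻¹] →+* (Fock K)⸨X⸩ :=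
  MvPolynomial.eval₂Hom
    (LaurentPolynomial.eval₂ ((HahnSeries.C : Fock K →+* (Fock K)⸨X⸩).comp MvPolynomial.C) zUnit)
    (fun n => HahnSeries.C (MvPolynomial.X n))

/-- `exp (s ∑_{n ≥ 1} (a_n / n) (z^n + z^{-n})) v` as a Laurent series in `z`. -/
def annihPart (s : ℚ) (v : Fock K) : (Fock K)⸨X⸩ :=
  toSeries (expAnnih
    (fun n : ℕ+ => s • (LaurentPolynomial.T (n : ℤ) + LaurentPolynomial.T (-(n : ℤ))))
    (MvPolynomial.map LaurentPolynomial.C v))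

/-- `exp (s ∑_{n ≥ 1} (a_{-n} / n) z^n)`, where `a_{-n}` is multiplication by the variable `X n`. -/
def createPart (s : ℚ) : (Fock K)⟦X⟧ :=
  (PowerSeries.exp (Fock K)).subst (PowerSeries.mk fun n : ℕ =>
    if h : 0 < n then (s / n) • (MvPolynomial.X (⟨n, h⟩ : ℕ+) : Fock K) else 0)

/-- The series `(1 + s z) exp (s ∑ (a_{-n} / n) z^n) exp (-s ∑ (a_n / n) (z^n + z^{-n})) v`:
this is `U(z) v` for `s = 1` and `U^*(z) v` for `s = -1`. -/
def vertexSeries (s : ℚ) (v : Fock K) : (Fock K)⸨X⸩ :=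
  (1 + s • HahnSeries.single (1 : ℤ) (1 : Fock K)) *
    HahnSeries.ofPowerSeries ℤ (Fock K) (createPart s) * annihPart (-s) v

theorem vertexSeries_add (s : ℚ) (v w : Fock K) :
    vertexSeries s (v + w) = vertexSeries s v + vertexSeries s w := by
  simp [vertexSeries, annihPart, mul_add]

theorem vertexSeries_smul (s : ℚ) (r : K) (v : Fock K) :
    vertexSeries s (r • v) = r • vertexSeries s v := by
  have h : annihPart (-s) (r • v) = HahnSeries.C (MvPolynomial.C r) * annihPart (-s) v := by
    rw [annihPart, MvPolynomial.smul_eq_C_mul, map_mul, MvPolynomial.map_C,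
      ← MvPolynomial.smul_eq_C_mul, map_smul, MvPolynomial.smul_eq_C_mul, map_mul]
    simp [annihPart, toSeries]
  have h' : r • vertexSeries s v = HahnSeries.C (MvPolynomial.C r) * vertexSeries s v := by
    ext1
    ext1 n
    simp [MvPolynomial.smul_eq_C_mul]
  rw [h', vertexSeries, h, vertexSeries]
  ring

/-- The operator extracting from `vertexSeries s` the coefficient of `z^n`. -/
def vertexCoeff (s : ℚ) (n : ℤ) : Module.End K (Fock K) where
  toFun v := (vertexSeries s v).coeff n
  map_add' v w := by rw [vertexSeries_add, HahnSeries.coeff_add]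
  map_smul' r v := by rw [vertexSeries_smul, HahnSeries.coeff_smul, RingHom.id_apply]

/-- `U_n`, where `U(z) = ∑_n U_n z^{-n}`. -/
def U (n : ℤ) : Module.End K (Fock K) := vertexCoeff 1 (-n)

/-- `U^*_n`, where `U^*(z) = ∑_n U^*_n z^n`. -/
def Ustar (n : ℤ) : Module.End K (Fock K) := vertexCoeff (-1) n

/-! ### The vectors `|λ^{so}⟩`, `⟨μ^{so}|` and the matrix coefficients -/

/-- Generalized partitions with `l` entries: `λ_1 ≥ … ≥ λ_l ≥ 0`, zero entries being allowed. -/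
abbrev GenPartition (l : ℕ) := {lam : Fin l → ℕ // Antitone lam}

/-- `|λ^{so}⟩ = U_{-λ_1} ⋯ U_{-λ_m} |0⟩`. -/
def ket {m : ℕ} (lam : GenPartition m) : Fock K :=
  (List.ofFn fun i => (U (-(lam.1 i : ℤ)) : Module.End K (Fock K))).prod 1

/-- `⟨μ^{so}| = ⟨0| U^*_{-μ_l} ⋯ U^*_{-μ_1}`, a linear form on the Fock space. -/
def bra {l : ℕ} (mu : GenPartition l) : Fock K →ₗ[K] K :=
  vacuumDual ∘ₗ (List.ofFn fun j => (Ustar (-(mu.1 j : ℤ)) : Module.End K (Fock K))).reverse.prod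

/-- The half vertex operator `Γ_+(x) = exp (∑_{n ≥ 1} (a_n / n) x^n)` in one variable. -/
def halfVertex (x : K) : Module.End K (Fock K) := expAnnih fun n : ℕ+ => x ^ (n : ℕ)

/-- `Γ_+(x^±) = ∏_i Γ_+(x_i) Γ_+(x_i⁻¹)`. -/
def GammaPlus {N : ℕ} (x : Fin N → K) : Module.End K (Fock K) :=
  (List.ofFn fun i => halfVertex (x i) * halfVertex (x i)⁻¹).prod

/-- The skew odd orthogonal character `so_{λ/μ}(x^±) = ⟨μ^{so}| Γ_+(x^±) |λ^{so}⟩`. -/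
def skewSO {l N : ℕ} (lam : GenPartition (l + N)) (mu : GenPartition l) (x : Fin N → K) : K :=
  bra mu (GammaPlus x (ket lam))

end Operators

section Characters

variable {K : Type*} [Field K]

/-! ### Complete homogeneous functions and the Jacobi–Trudi matrix -/

/-- `h_n(x^±)`: the coefficient of `z^n` in `∏_i 1 / ((1 - x_i z) (1 - x_i⁻¹ z))`, and `0` for
`n < 0`. -/
def hPM {N : ℕ} (x : Fin N → K) (n : ℤ) : K :=
  if 0 ≤ n then
    PowerSeries.coeff n.toNat (∏ i, ((1 - PowerSeries.C (x i) * PowerSeries.X)⁻¹ *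
      (1 - PowerSeries.C (x i)⁻¹ * PowerSeries.X)⁻¹ : K⟦X⟧))
  else 0

/-- The Jacobi–Trudi matrix.  With indices counted from `1` its entries are
`h_{λ_i - μ_j - i + j}` for `j ≤ l` and `h_{λ_i - i + j} + h_{λ_i - i - j + 2l + 1}` for `j > l`;
here `i` and `j` count from `0`, which turns `2l + 1` into `2l - 1`. -/
def jtMatrix {l N : ℕ} (lam : GenPartition (l + N)) (mu : GenPartition l) (x : Fin N → K) :
    Matrix (Fin (l + N)) (Fin (l + N)) K :=
  Matrix.of fun i j =>
    if hj : (j : ℕ) < l then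
      hPM x ((lam.1 i : ℤ) - (mu.1 ⟨j, hj⟩ : ℤ) - (i : ℤ) + (j : ℤ))
    else
      hPM x ((lam.1 i : ℤ) - (i : ℤ) + (j : ℤ)) +
        hPM x ((lam.1 i : ℤ) - (i : ℤ) - (j : ℤ) + 2 * (l : ℤ) - 1)

/-! ### The odd orthogonal characters, by the Weyl character formula -/

/-- `det (x_i^{ν_j + N - j + 1/2} - x_i^{-(ν_j + N - j + 1/2)})`, where `t_i = x_i^{1/2}` and `j` runs
through `1, …, N`; here `j` counts from `0`, so that the exponent of `t_i` is `2 (ν_j + N - j) - 1`. -/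
def weylDet {N : ℕ} (nu : Fin N → ℕ) (t : Fin N → K) : K :=
  Matrix.det (Matrix.of fun i j : Fin N =>
    t i ^ (2 * ((nu j : ℤ) + (N : ℤ) - (j : ℤ)) - 1) -
      t i ^ (-(2 * ((nu j : ℤ) + (N : ℤ) - (j : ℤ)) - 1)))

/-- The odd orthogonal character `so_ν(x^±)` of `SO(2N+1)`, at `x_i = t_i²`. -/
def oddOrthChar {N : ℕ} (nu : GenPartition N) (t : Fin N → K) : K :=
  weylDet nu.1 t / weylDet 0 t

end Characters

end OddOrth

end

/-! Put t = z + z⁻¹ and H(z) = exp(∑ a_{-n} zⁿ / n). The exponential of annihilation operators is a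
translation of the variables (`expAnnih_apply`). Hence U(z) is a substitution followed by
multiplication by (1 + z) H(z), and the substitution sends H(w) to (1 - t w + w²) H(w) = w (w + w⁻¹
- t) H(w). In a product of operators U these factors assemble into a Vandermonde determinant in the
t_i. So |λ^{so}⟩ is the determinant whose entry (i, j), counted from 0, is the coefficient of z^{λ_i
- i} in t^j (1 + z) H(z) (`prod_U_apply_one`, `soDet`). On the dual side, ⟨μ^{so}| v is the
coefficient of ∏ w_j^{-μ_j} in the value of v at a_{-n} = ∑ (w_i^n + w_i^{-n}), weighted by ∏ (1 -
w_i) ∏_{i<j} (1 - w_i w_j)(1 - w_i / w_j) (`exists_bra_eq`).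

The engine is `det_mul_revVandermonde`. In such a determinant the powers t^j may be replaced by
other polynomials in t, at the cost of the determinant of the change of basis. Let H be replaced by
F = G / ∏ (1 - T_i z + z²). Since z (t - T_i) = 1 - T_i z + z², the polynomial ∏_{i≠j} (t - T_i)
cancels all denominators but one, and ∏ (t - T_i) p(t) cancels all of them. The change of basis
costs ∏_{i<j} (T_i - T_j).

Jacobi–Trudi: take T_i = w_i + w_i⁻¹. The weight of the bra contains exactly this product, and (1 -
w) χ_k(w + w⁻¹) = w^{-k} - w^{k+1}, with χ_k as in `chi`, so the coefficient of w_j^{-μ_j} selects a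
single k in each of the first l columns (`skewSO_eq_det`). Weyl formula: take G = 1 with as many T_i
as rows; the entries become χ_k(T_j), which are the Weyl entries up to column factors
(`weylDet_eq`). Branching: take T_i = y_i + y_i⁻¹ and expand the first l columns by Cauchy–Binet
(`soDet_mul_eq_sum`). Vanishing of ∏ (T_i - T_j) is avoided by first treating the T_i as
indeterminates. -/

noncomputable section

namespace OddOrth

/-! ### Determinants of linear functionals on polynomials and change of basis -/

open Polynomial Finset in
/-- Linear functionals on polynomials of bounded degree: changing the family of polynomials
multiplies the determinant by that of the coefficient matrix. -/
theorem det_functional_eq {R : Type*} [CommRing R] {n : ℕ} (L : Fin n → R[X] →ₗ[R] R)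
    (q : Fin n → R[X]) (hq : ∀ j, (q j).natDegree < n) :
    (Matrix.of fun i j => L i (q j)).det =
      (Matrix.of fun i j : Fin n => L i (X ^ (j : ℕ))).det *
        (Matrix.of fun k j : Fin n => (q j).coeff k).det := by
  rw [← Matrix.det_mul]
  congr 1
  ext i j
  rw [Matrix.of_apply, Matrix.mul_apply]
  conv_lhs => rw [(q j).as_sum_range' n (hq j), map_sum]
  rw [← Fin.sum_univ_eq_sum_range (fun k => L i (monomial k ((q j).coeff k)))]
  refine Finset.sum_congr rfl fun k _ => ?_
  rw [← C_mul_X_pow_eq_monomial, ← smul_eq_C_mul, map_smul, Matrix.of_apply, Matrix.of_apply,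
    smul_eq_mul, mul_comm]

open Polynomial Finset in
theorem det_coeff_unitriangular {R : Type*} [CommRing R] {n : ℕ}
    (q : Fin n → R[X]) (hq : ∀ j, (q j).natDegree ≤ j) (hm : ∀ j, (q j).coeff j = 1) :
    (Matrix.of fun k j : Fin n => (q j).coeff k).det = 1 := by
  rw [Matrix.det_of_isUpperTriangular (Matrix.matrixOfPolynomials_blockTriangular q hq)]
  exact prod_eq_one fun i _ => hm i

/-- The product `∏_{i<j} (T_i - T_j)`. -/
def revVandermonde {R : Type*} [CommRing R] {l : ℕ} (T : Fin l → R) : R :=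
  ∏ i, ∏ j ∈ Finset.Ioi i, (T i - T j)

-- For indeterminate T_i, evaluation at the T_i makes these Lagrange-type polynomials diagonal, so
-- the Vandermonde determinant times the wanted one is a product of differences. Cancelling the
-- Vandermonde determinant there and then specialising covers coinciding T_i.
open Polynomial Finset in
theorem det_coeff_prod_erase {R : Type*} [CommRing R] {l : ℕ} (T : Fin l → R) :
    (Matrix.of fun k j : Fin l => (∏ i ∈ univ.erase j, (X - C (T i))).coeff k).det
      = revVandermonde T := by
  have key : (Matrix.of fun k j : Fin l => (∏ i ∈ univ.erase j,
      (X - C (MvPolynomial.X i : MvPolynomial (Fin l) ℤ))).coeff k).det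
      = revVandermonde MvPolynomial.X := by
    set Y : Fin l → MvPolynomial (Fin l) ℤ := MvPolynomial.X
    have hY : Function.Injective Y := MvPolynomial.X_injective
    have h0 : (Matrix.vandermonde Y).det ≠ 0 := Matrix.det_vandermonde_ne_zero_iff.2 hY
    refine mul_left_cancel₀ h0 ?_
    have h1 := det_functional_eq (fun i => Polynomial.leval (Y i))
      (fun j => ∏ i ∈ univ.erase j, (X - C (Y i))) (fun j => by
        rw [natDegree_prod_of_monic _ _ fun i _ => monic_X_sub_C _]
        simp only [natDegree_X_sub_C, sum_const, card_erase_of_mem (mem_univ j), card_univ,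
          Fintype.card_fin, smul_eq_mul, mul_one]
        have := j.2
        omega)
    have h2 : (Matrix.of fun i j : Fin l => Polynomial.leval (Y i) (X ^ (j : ℕ)))
        = Matrix.vandermonde Y := by
      ext i j : 1
      simp [Matrix.vandermonde]
    rw [h2] at h1
    rw [← h1]
    have h3 : (Matrix.of fun i j : Fin l =>
        Polynomial.leval (Y i) (∏ k ∈ univ.erase j, (X - C (Y k))))
        = Matrix.diagonal fun j => ∏ k ∈ univ.erase j, (Y j - Y k) := by
      ext i j : 1
      by_cases hij : i = j
      · subst hij
        simp [eval_prod]
      · rw [Matrix.diagonal_apply_ne _ hij]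
        simp only [Matrix.of_apply, Polynomial.leval_apply, eval_prod, eval_sub, eval_X, eval_C]
        exact prod_eq_zero (f := fun k => Y i - Y k) (mem_erase.2 ⟨hij, mem_univ i⟩) (sub_self _)
    rw [h3, Matrix.det_diagonal, Matrix.det_vandermonde, revVandermonde]
    -- The factors with k > j form `revVandermonde`; those with k < j form the Vandermonde
    -- determinant to be cancelled.
    have h4 : ∀ j : Fin l, ∏ k ∈ univ.erase j, (Y j - Y k)
        = (∏ k ∈ Ioi j, (Y j - Y k)) * ∏ k ∈ Iio j, (Y j - Y k) := by
      intro j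
      rw [← prod_union]
      · congr 1
        ext k
        simp [lt_or_lt_iff_ne, eq_comm]
      · exact Finset.disjoint_left.2 fun k h h' => by
          simp at h h'
          exact absurd h (not_lt.2 h'.le)
    simp only [h4, prod_mul_distrib]
    rw [mul_comm]
    congr 1
    exact prod_comm' (by simp)
  have := congrArg (MvPolynomial.aeval T : MvPolynomial (Fin l) ℤ →ₐ[ℤ] R) key
  rw [AlgHom.map_det] at this
  convert this using 1
  · congr 1
    ext k j
    simp only [AlgHom.mapMatrix_apply, Matrix.map_apply, Matrix.of_apply]
    rw [← AlgHom.coe_toRingHom, ← Polynomial.coeff_map, Polynomial.map_prod]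
    simp
  · simp [revVandermonde]

-- The first l polynomials have degree below l, so the coefficient matrix is block triangular. The
-- lower right block is unitriangular because ∏ (X - T_i) is monic of degree l.
open Polynomial Finset in
theorem det_coeff_block {R : Type*} [CommRing R] {l N : ℕ} (T : Fin l → R)
    (p : Fin N → R[X]) (hp : ∀ j, (p j).natDegree ≤ j) (hm : ∀ j, (p j).coeff j = 1) :
    (Matrix.of fun k j : Fin (l + N) => (Fin.addCases
      (fun j => ∏ i ∈ univ.erase j, (X - C (T i)))
      (fun j => (∏ i, (X - C (T i))) * p j) j : R[X]).coeff k).det = revVandermonde T := by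
  nontriviality R
  have hQ : (∏ i, (X - C (T i))).natDegree = l := by
    rw [natDegree_prod_of_monic _ _ fun i _ => monic_X_sub_C _]
    simp
  have hQm : (∏ i, (X - C (T i))).coeff l = 1 := by
    have : (∏ i, (X - C (T i))).Monic := monic_prod_of_monic _ _ fun i _ => monic_X_sub_C _
    rwa [Monic, leadingCoeff, hQ] at this
  rw [← Matrix.det_submatrix_equiv_self finSumFinEquiv]
  have h : (Matrix.of fun k j : Fin (l + N) => (Fin.addCases
      (fun j => ∏ i ∈ univ.erase j, (X - C (T i)))
      (fun j => (∏ i, (X - C (T i))) * p j) j : R[X]).coeff k).submatrix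
        finSumFinEquiv finSumFinEquiv
      = Matrix.fromBlocks
        (Matrix.of fun k j : Fin l => (∏ i ∈ univ.erase j, (X - C (T i))).coeff k)
        (Matrix.of fun (k : Fin l) (j : Fin N) => ((∏ i, (X - C (T i))) * p j).coeff k) 0
        (Matrix.of fun k j : Fin N => ((∏ i, (X - C (T i))) * p j).coeff (l + k)) := by
    ext k j
    rcases k with k | k <;> rcases j with j | j
    · simp
    · simp
    · simp only [Matrix.submatrix_apply, finSumFinEquiv_apply_left, finSumFinEquiv_apply_right,
        Matrix.of_apply, Fin.addCases_left, Matrix.fromBlocks_apply₂₁, Matrix.zero_apply]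
      refine coeff_eq_zero_of_natDegree_lt ?_
      rw [natDegree_prod_of_monic _ _ fun i _ => monic_X_sub_C _]
      simp only [natDegree_X_sub_C, sum_const, card_erase_of_mem (mem_univ j), card_univ,
        Fintype.card_fin, smul_eq_mul, mul_one, Fin.val_natAdd]
      have := j.2
      omega
    · simp
  rw [h, Matrix.det_fromBlocks_zero₂₁, det_coeff_prod_erase,
    Matrix.det_of_isUpperTriangular, prod_eq_one, mul_one]
  · intro j _
    rw [Matrix.of_apply, coeff_mul_add_eq_of_natDegree_le hQ.le (hp j), hQm, hm, mul_one]
  · intro k j hkj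
    have hkj' : j < k := hkj
    rw [Matrix.of_apply]
    refine coeff_eq_zero_of_natDegree_lt (natDegree_mul_le.trans_lt ?_)
    rw [hQ]
    have := hp j
    have : (j : ℕ) < k := hkj'
    omega

/-! ### Two-sided sequences and the action of `t = z + z⁻¹` -/

section Sequences

variable {R : Type*} [CommRing R]

/-- The coefficients of a power series, extended by `0` to negative indices. -/
def powerSeriesSeq (F : R⟦X⟧) (n : ℤ) : R :=
  if 0 ≤ n then PowerSeries.coeff n.toNat F else 0

theorem powerSeriesSeq_of_neg (F : R⟦X⟧) {n : ℤ} (h : n < 0) : powerSeriesSeq F n = 0 :=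
  if_neg (not_le.2 h)

@[simp]
theorem powerSeriesSeq_natCast (F : R⟦X⟧) (n : ℕ) :
    powerSeriesSeq F n = PowerSeries.coeff n F := by
  simp [powerSeriesSeq]

theorem powerSeriesSeq_X_mul (F : R⟦X⟧) (n : ℤ) :
    powerSeriesSeq (PowerSeries.X * F) n = powerSeriesSeq F (n - 1) := by
  rcases lt_trichotomy n 0 with h | h | h
  · rw [powerSeriesSeq_of_neg _ h, powerSeriesSeq_of_neg _ (by omega)]
  · subst h
    rw [powerSeriesSeq_of_neg F (by omega)]
    simp [powerSeriesSeq]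
  · obtain ⟨k, rfl⟩ : ∃ k : ℕ, n = (k + 1 : ℕ) := ⟨(n - 1).toNat, by omega⟩
    rw [powerSeriesSeq_natCast, PowerSeries.coeff_succ_X_mul]
    simp

theorem powerSeriesSeq_add (F G : R⟦X⟧) (n : ℤ) :
    powerSeriesSeq (F + G) n = powerSeriesSeq F n + powerSeriesSeq G n := by
  unfold powerSeriesSeq; split_ifs <;> simp

theorem powerSeriesSeq_sub (F G : R⟦X⟧) (n : ℤ) :
    powerSeriesSeq (F - G) n = powerSeriesSeq F n - powerSeriesSeq G n := by
  unfold powerSeriesSeq; split_ifs <;> simp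

theorem powerSeriesSeq_C_mul (r : R) (F : R⟦X⟧) (n : ℤ) :
    powerSeriesSeq (PowerSeries.C r * F) n = r * powerSeriesSeq F n := by
  unfold powerSeriesSeq; split_ifs <;> simp

theorem map_powerSeriesSeq {S : Type*} [CommRing S] (f : R →+* S) (F : R⟦X⟧) (n : ℤ) :
    f (powerSeriesSeq F n) = powerSeriesSeq (PowerSeries.map f F) n := by
  unfold powerSeriesSeq; split_ifs <;> simp

/-- The power series `1 - T z + z²`. -/
def quadSeries (T : R) : R⟦X⟧ := 1 - PowerSeries.C T * PowerSeries.X + PowerSeries.X ^ 2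

theorem powerSeriesSeq_quadSeries_mul (T : R) (F : R⟦X⟧) (n : ℤ) :
    powerSeriesSeq (quadSeries T * F) n =
      powerSeriesSeq F n - T * powerSeriesSeq F (n - 1) + powerSeriesSeq F (n - 2) := by
  have : quadSeries T * F = F - PowerSeries.C T * (PowerSeries.X * F)
      + PowerSeries.X * (PowerSeries.X * F) := by
    rw [quadSeries]; ring
  rw [this, powerSeriesSeq_add, powerSeriesSeq_sub, powerSeriesSeq_C_mul]
  simp only [powerSeriesSeq_X_mul, sub_sub]
  norm_num

theorem isUnit_quadSeries (T : R) : IsUnit (quadSeries T) := by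
  rw [PowerSeries.isUnit_iff_constantCoeff]
  simp [quadSeries]

/-- The operator `(τ c)_n = c_{n-1} + c_{n+1}` on sequences, that is, multiplication of
`∑ c_n z^n` by `z + z⁻¹`. -/
def tau : Module.End R (ℤ → R) where
  toFun c n := c (n - 1) + c (n + 1)
  map_add' c d := by ext n; simp; ring
  map_smul' r c := by ext n; simp; ring

@[simp] theorem tau_apply (c : ℤ → R) (n : ℤ) : tau c n = c (n - 1) + c (n + 1) := rfl

/-- The sequence of coefficients of `(1 + z) ∑ c_n z^n`. -/
def onePlus (c : ℤ → R) (n : ℤ) : R := c n + c (n - 1)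

/-- The functional taking `p` to the coefficient of `z^n` in `p(z + z⁻¹) ∑ c_n z^n`. -/
def coeffFunctional (c : ℤ → R) (n : ℤ) : Polynomial R →ₗ[R] R :=
  LinearMap.proj n ∘ₗ (LinearMap.applyₗ c) ∘ₗ
    (Polynomial.aeval (tau : Module.End R (ℤ → R))).toLinearMap

theorem coeffFunctional_apply (c : ℤ → R) (n : ℤ) (p : Polynomial R) :
    coeffFunctional c n p = Polynomial.aeval (tau : Module.End R (ℤ → R)) p c n := rfl

theorem coeffFunctional_mul (c : ℤ → R) (n : ℤ) (p q : Polynomial R) :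
    coeffFunctional c n (p * q) = coeffFunctional (fun m => coeffFunctional c m q) n p := by
  simp only [coeffFunctional_apply, map_mul]
  rfl

@[simp]
theorem coeffFunctional_one (c : ℤ → R) (n : ℤ) : coeffFunctional c n 1 = c n := by
  simp [coeffFunctional_apply]

@[simp]
theorem coeffFunctional_X (c : ℤ → R) (n : ℤ) :
    coeffFunctional c n Polynomial.X = c (n - 1) + c (n + 1) := by
  simp [coeffFunctional_apply]

@[simp]
theorem coeffFunctional_C (c : ℤ → R) (n : ℤ) (r : R) :
    coeffFunctional c n (Polynomial.C r) = r * c n := by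
  simp [coeffFunctional_apply]

theorem coeffFunctional_X_sub_C (c : ℤ → R) (n : ℤ) (T : R) :
    coeffFunctional c n (Polynomial.X - Polynomial.C T) = c (n - 1) - T * c n + c (n + 1) := by
  rw [map_sub, coeffFunctional_X, coeffFunctional_C]; ring

theorem coeffFunctional_shift (c : ℤ → R) (n k : ℤ) (p : Polynomial R) :
    coeffFunctional (fun m => c (m + k)) n p = coeffFunctional c (n + k) p := by
  induction p using Polynomial.induction_on' generalizing n with
  | add p q hp hq => rw [map_add, map_add, hp, hq]
  | monomial d a =>
    rw [← Polynomial.C_mul_X_pow_eq_monomial]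
    induction d generalizing n with
    | zero => simp
    | succ d ih =>
      rw [pow_succ, mul_comm _ Polynomial.X, mul_left_comm, coeffFunctional_mul,
        coeffFunctional_mul c]
      simp only [coeffFunctional_X, ih]
      rw [show n - 1 + k = n + k - 1 by ring, show n + 1 + k = n + k + 1 by ring]

theorem map_coeffFunctional {S : Type*} [CommRing S] (f : R →+* S) (c : ℤ → R) (n : ℤ)
    (p : Polynomial R) :
    f (coeffFunctional c n p) = coeffFunctional (fun m => f (c m)) n (p.map f) := by
  induction p using Polynomial.induction_on' generalizing n with
  | add p q hp hq => rw [Polynomial.map_add, map_add, map_add, map_add, hp, hq]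
  | monomial d a =>
    rw [← Polynomial.C_mul_X_pow_eq_monomial]
    induction d generalizing n with
    | zero => simp
    | succ d ih =>
      rw [pow_succ, mul_comm _ Polynomial.X, mul_left_comm, coeffFunctional_mul,
        Polynomial.map_mul, coeffFunctional_mul (fun m => f (c m)), Polynomial.map_X]
      simp only [coeffFunctional_X, map_add, ih]

/-- Multiplication by z + z⁻¹ lowers the order of a series by at most one. -/
theorem coeffFunctional_eq_zero (c : ℤ → R) (hc : ∀ n < 0, c n = 0) (p : Polynomial R) (n : ℤ)
    (hn : n + p.natDegree < 0) : coeffFunctional c n p = 0 := by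
  have h : ∀ (d : ℕ) (n : ℤ), n + d < 0 → coeffFunctional c n (Polynomial.X ^ d) = 0 := by
    intro d
    induction d with
    | zero => intro n hn; simpa using hc n (by simpa using hn)
    | succ d ih =>
      intro n hn
      push_cast at hn
      rw [pow_succ', coeffFunctional_mul, coeffFunctional_X, ih _ (by omega), ih _ (by omega),
        add_zero]
  rw [p.as_sum_range, map_sum]
  refine Finset.sum_eq_zero fun d hd => ?_
  rw [Finset.mem_range] at hd
  rw [← Polynomial.C_mul_X_pow_eq_monomial, ← Polynomial.smul_eq_C_mul, map_smul,
    h d n (by omega), smul_zero]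

theorem onePlus_of_neg {c : ℤ → R} (hc : ∀ n < 0, c n = 0) (n : ℤ) (hn : n < 0) :
    onePlus c n = 0 := by
  rw [onePlus, hc _ hn, hc _ (by omega), add_zero]

/-- The polynomials with `(1 + z) p_j(z + z⁻¹) = z^{j+1} + z^{-j}`. -/
def foldPoly (R : Type*) [CommRing R] : ℕ → Polynomial R
  | 0 => 1
  | 1 => Polynomial.X - 1
  | j + 2 => Polynomial.X * foldPoly R (j + 1) - foldPoly R j

theorem natDegree_foldPoly_le (j : ℕ) : (foldPoly R j).natDegree ≤ j := by
  induction j using Nat.twoStepInduction with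
  | zero => simp [foldPoly]
  | one => exact (Polynomial.natDegree_sub_le _ _).trans (by simp [Polynomial.natDegree_X_le])
  | more j h0 h1 =>
    rw [foldPoly]
    refine (Polynomial.natDegree_sub_le _ _).trans (max_le ?_ (by omega))
    refine Polynomial.natDegree_mul_le.trans ?_
    have := Polynomial.natDegree_X_le (R := R)
    omega

theorem coeff_foldPoly_self (j : ℕ) : (foldPoly R j).coeff j = 1 := by
  induction j using Nat.twoStepInduction with
  | zero => simp [foldPoly]
  | one => simp [foldPoly, Polynomial.coeff_one]
  | more j h0 h1 =>
    rw [foldPoly, Polynomial.coeff_sub, Polynomial.coeff_X_mul, h1,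
      Polynomial.coeff_eq_zero_of_natDegree_lt, sub_zero]
    exact (natDegree_foldPoly_le j).trans_lt (by omega)

theorem coeffFunctional_foldPoly (c : ℤ → R) (j : ℕ) (n : ℤ) :
    coeffFunctional (onePlus c) n (foldPoly R j) = c (n - j - 1) + c (n + j) := by
  induction j using Nat.twoStepInduction generalizing n with
  | zero => simp [foldPoly, onePlus, add_comm]
  | one =>
    rw [foldPoly, map_sub, coeffFunctional_X, coeffFunctional_one]
    simp only [onePlus, Nat.cast_one, add_sub_cancel_right]
    ring
  | more j h0 h1 =>
    rw [foldPoly, map_sub, coeffFunctional_mul, coeffFunctional_X, h1, h1, h0]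
    push_cast
    rw [show n - 1 - (j + 1) - 1 = n - (j + 2 : ℤ) - 1 by ring,
      show n - 1 + (j + 1 : ℤ) = n + j by ring, show n + 1 - (j + 1) - 1 = n - (j : ℤ) - 1 by ring,
      show n + 1 + (j + 1 : ℤ) = n + (j + 2) by ring]
    ring

/-- The coefficients of `(1 + z) / (1 - T z + z²)`. -/
def chi (T : R) : ℕ → R
  | 0 => 1
  | 1 => 1 + T
  | k + 2 => T * chi T (k + 1) - chi T k

/-- The recurrence says (1 - T z + z²) v = (1 + z) G, so v is the convolution of G with `chi T`.
Since G vanishes in negative degrees, any bound B > n truncates the sum without loss. -/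
theorem eq_sum_chi_of_recurrence (T : R) (v G : ℤ → R) (hG : ∀ n < 0, G n = 0)
    (hv0 : ∀ n < 0, v n = 0)
    (hv : ∀ n, v n - T * v (n - 1) + v (n - 2) = onePlus G n) (B : ℕ) (n : ℤ) (hn : n < B) :
    v n = ∑ k ∈ Finset.range B, chi T k * G (n - k) := by
  have ext : ∀ (B B' : ℕ) (n : ℤ), n < B → n < B' →
      ∑ k ∈ Finset.range B, chi T k * G (n - k) = ∑ k ∈ Finset.range B', chi T k * G (n - k) := by
    have aux : ∀ (B B' : ℕ) (n : ℤ), B ≤ B' → n < B →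
      ∑ k ∈ Finset.range B, chi T k * G (n - k) = ∑ k ∈ Finset.range B', chi T k * G (n - k) := by
      intro B B' n hB hn
      refine Finset.sum_subset (Finset.range_mono hB) fun k _ hk => ?_
      rw [hG _ (by simp at hk; omega), mul_zero]
    intro B B' n h h'
    rcases le_total B B' with hB | hB
    · exact aux _ _ _ hB h
    · exact (aux _ _ _ hB h').symm
  have main : ∀ (m : ℕ) (n : ℤ), n < m → v n = ∑ k ∈ Finset.range m, chi T k * G (n - k) := by
    intro m
    induction m with
    | zero => intro n hn; simpa using hv0 n (by simpa using hn)
    | succ m ih =>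
      intro n hn
      push_cast at hn
      rcases lt_or_eq_of_le (show n ≤ m by omega) with h | rfl
      · rw [ih n h]; exact ext _ _ _ h (by push_cast; omega)
      have h := hv m
      have h1 := ih (m - 1) (by omega)
      have h2 := ih (m - 2) (by omega)
      -- The three sums are padded with zero terms so that, after the head terms are split off, all
      -- run over `range (m + 1)` and the recurrence of `chi` applies termwise.
      rw [ext m (m + 2) _ (by omega) (by push_cast; omega)] at h1
      rw [ext m (m + 1) _ (by omega) (by push_cast; omega)] at h2
      rw [ext (m + 1) (m + 3) _ (by push_cast; omega) (by push_cast; omega)]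
      rw [Finset.sum_range_succ'] at h1
      rw [Finset.sum_range_succ', Finset.sum_range_succ']
      have e : ∑ k ∈ Finset.range (m + 1), chi T (k + 1 + 1) * G (m - ((k + 1 + 1 : ℕ) : ℤ))
        = T * ∑ k ∈ Finset.range (m + 1), chi T (k + 1) * G (m - 1 - ((k + 1 : ℕ) : ℤ))
          - ∑ k ∈ Finset.range (m + 1), chi T k * G (m - 2 - (k : ℤ)) := by
        rw [Finset.mul_sum, ← Finset.sum_sub_distrib]
        refine Finset.sum_congr rfl fun k _ => ?_
        rw [chi]
        push_cast
        rw [show (m : ℤ) - (k + 1 + 1) = m - 2 - k by ring,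
          show (m : ℤ) - 1 - (k + 1) = m - 2 - k by ring]
        ring
      rw [e]
      rw [h1, h2, onePlus] at h
      simp only [zero_add, Nat.cast_zero, Nat.cast_one, sub_zero, chi] at h ⊢
      linear_combination h
  rcases lt_or_ge n 0 with h | h
  · rw [hv0 n h]
    exact (Finset.sum_eq_zero fun k _ => by rw [hG _ (by omega), mul_zero]).symm
  · exact main B n hn

end Sequences

/-! ### Clearing the denominators 1 - T z + z² in determinants -/

section Bialternant

variable {R : Type*} [CommRing R]

-- Each factor satisfies z (t - T) = 1 - T z + z², which accounts for the shift of the index by the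
-- number of factors.
open Polynomial in
theorem coeffFunctional_prod_X_sub_C {ι : Type*} [DecidableEq ι] (s : Finset ι) (T : ι → R)
    (F : R⟦X⟧) (n : ℤ) :
    coeffFunctional (onePlus (powerSeriesSeq F)) n (∏ i ∈ s, (X - C (T i))) =
      onePlus (powerSeriesSeq ((∏ i ∈ s, quadSeries (T i)) * F)) (n + s.card) := by
  induction s using Finset.induction_on generalizing n with
  | empty => simp
  | insert a s ha ih =>
    rw [Finset.prod_insert ha, Finset.prod_insert ha, coeffFunctional_mul,
      coeffFunctional_X_sub_C, ih, ih, ih, Finset.card_insert_of_notMem ha, mul_assoc]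
    simp only [onePlus, powerSeriesSeq_quadSeries_mul]
    push_cast
    rw [show n + ((s.card : ℤ) + 1) = n + 1 + s.card by ring,
      show n + 1 + (s.card : ℤ) - 1 = n + s.card by ring,
      show n + 1 + (s.card : ℤ) - 2 = n + s.card - 1 by ring,
      show n - 1 + (s.card : ℤ) = n + s.card - 1 by ring,
      show n + (s.card : ℤ) - 1 - 1 = n + s.card - 2 by ring]
    ring

-- All denominators of F except the j-th cancel, leaving (1 + z) G / (1 - T_j z + z²), whose
-- coefficients are the convolution with `chi (T j)`.
open Polynomial in
theorem coeffFunctional_prod_erase {l : ℕ} (T : Fin l → R) (F G : R⟦X⟧)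
    (hFG : (∏ i, quadSeries (T i)) * F = G) (j : Fin l) (n : ℤ) (B : ℕ) (hn : n + l - 1 < B) :
    coeffFunctional (onePlus (powerSeriesSeq F)) n (∏ i ∈ Finset.univ.erase j, (X - C (T i))) =
      ∑ k ∈ Finset.range B, chi (T j) k * powerSeriesSeq G (n + l - 1 - k) := by
  have hcard : ((Finset.univ.erase j).card : ℤ) = l - 1 := by
    rw [Finset.card_erase_of_mem (Finset.mem_univ j), Finset.card_univ, Fintype.card_fin]
    have := j.2
    omega
  rw [coeffFunctional_prod_X_sub_C, hcard]
  set F' := (∏ i ∈ Finset.univ.erase j, quadSeries (T i)) * F with hF'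
  have hG : G = quadSeries (T j) * F' := by
    rw [hF', ← mul_assoc, Finset.mul_prod_erase _ (fun i => quadSeries (T i)) (Finset.mem_univ j), hFG]
  rw [eq_sum_chi_of_recurrence (T j) (onePlus (powerSeriesSeq F')) (powerSeriesSeq G)
    (fun n hn => powerSeriesSeq_of_neg G hn)
    (onePlus_of_neg fun n hn => powerSeriesSeq_of_neg F' hn) _ B _ (by omega)]
  · simp only [add_sub_assoc]
  · intro n
    rw [hG]
    simp only [onePlus, powerSeriesSeq_quadSeries_mul]
    rw [show n - 2 - 1 = n - 1 - 2 by ring, show n - 1 - 1 = n - 2 by ring]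
    ring

open Polynomial in
/-- Dividing the generating function `G` by `∏ (1 - T_j z + z²)` in a determinant of
odd orthogonal type and clearing the denominator `∏_{i<j} (T_i - T_j)`. -/
theorem det_mul_revVandermonde {l N : ℕ} (T : Fin l → R) (F G : R⟦X⟧)
    (hFG : (∏ i, quadSeries (T i)) * F = G) (m : Fin (l + N) → ℤ) (B : ℕ)
    (hB : ∀ i, m i + l - 1 < B) :
    (Matrix.of fun i j : Fin (l + N) =>
      coeffFunctional (onePlus (powerSeriesSeq F)) (m i) (X ^ (j : ℕ))).det * revVandermonde T =
    (Matrix.of fun i j : Fin (l + N) => (Fin.addCases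
      (fun j => ∑ k ∈ Finset.range B, chi (T j) k * powerSeriesSeq G (m i + l - 1 - k))
      (fun j => powerSeriesSeq G (m i + l - (j : ℕ) - 1) + powerSeriesSeq G (m i + l + (j : ℕ)))
      j : R)).det := by
  nontriviality R
  rw [← det_coeff_block T (fun j : Fin N => foldPoly R j) (fun j => natDegree_foldPoly_le j)
    (fun j => coeff_foldPoly_self j), ← det_functional_eq]
  · congr 1
    ext i j
    rw [Matrix.of_apply, Matrix.of_apply]
    induction j using Fin.addCases with
    | left j =>
      simp only [Fin.addCases_left]
      exact coeffFunctional_prod_erase T F G hFG j (m i) B (hB i)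
    | right j =>
      simp only [Fin.addCases_right]
      rw [mul_comm, coeffFunctional_mul]
      simp only [coeffFunctional_prod_X_sub_C, hFG, coeffFunctional_shift, Finset.card_univ,
        Fintype.card_fin, coeffFunctional_foldPoly]
  · intro j
    induction j using Fin.addCases with
    | left j =>
      simp only [Fin.addCases_left]
      rw [natDegree_prod_of_monic _ _ fun i _ => monic_X_sub_C _]
      simp only [natDegree_X_sub_C, Finset.sum_const, Finset.card_erase_of_mem (Finset.mem_univ j),
        Finset.card_univ, Fintype.card_fin, smul_eq_mul, mul_one]
      have := j.2
      omega
    | right j =>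
      simp only [Fin.addCases_right]
      refine natDegree_mul_le.trans_lt ?_
      rw [natDegree_prod_of_monic _ _ fun i _ => monic_X_sub_C _]
      have h := natDegree_foldPoly_le (R := R) (j : ℕ)
      have := j.2
      simp only [natDegree_X_sub_C, Finset.sum_const, Finset.card_univ, Fintype.card_fin,
        smul_eq_mul, mul_one]
      omega

end Bialternant

/-! ### The Heisenberg operators as algebra homomorphisms -/

section Heisenberg

variable {A : Type*} [CommRing A]

/-- The substitution `a_{-n} ↦ a_{-n} + c_n`. -/
def translate (c : ℕ+ → A) : Fock A →ₐ[A] Fock A :=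
  MvPolynomial.aeval fun n => MvPolynomial.X n + MvPolynomial.C (c n)

theorem translate_translate (c d : ℕ+ → A) (v : Fock A) :
    translate c (translate d v) = translate (c + d) v := by
  rw [← AlgHom.comp_apply]
  congr 1
  ext n
  simp [translate, add_assoc]

theorem translate_zero : translate (0 : ℕ+ → A) = AlgHom.id A (Fock A) := by
  ext n
  simp [translate]

theorem vacuumDual_apply (v : Fock A) : vacuumDual v = MvPolynomial.constantCoeff v := rfl

theorem constantCoeff_translate (c : ℕ+ → A) (v : Fock A) :
    MvPolynomial.constantCoeff (translate c v) = MvPolynomial.aeval c v := by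
  induction v using MvPolynomial.induction_on with
  | C r => simp [translate]
  | add p q hp hq => simp [hp, hq]
  | mul_X p n hp => rw [map_mul, map_mul, hp]; simp [translate]

variable [Algebra ℚ A]

theorem annihSum_pow_mul_X (c : ℕ+ → A) (v : Fock A) (n : ℕ+) (k : ℕ) :
    (annihSum c ^ (k + 1)) (v * MvPolynomial.X n)
      = (annihSum c ^ (k + 1)) v * MvPolynomial.X n
        + ((k + 1 : ℕ) : ℚ) • c n • (annihSum c ^ k) v := by
  induction k with
  | zero => simp [annihSum_mul_X]
  | succ k ih =>
    have hq : annihSum c (((k + 1 : ℕ) : ℚ) • c n • (annihSum c ^ k) v)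
        = ((k + 1 : ℕ) : ℚ) • c n • (annihSum c ^ (k + 1)) v := by
      rw [LinearMap.map_smul_of_tower, map_smul, ← Module.End.mul_apply, ← pow_succ']
    rw [pow_succ', Module.End.mul_apply, ih, map_add, annihSum_mul_X, hq, add_assoc,
      ← Module.End.mul_apply, ← pow_succ' (annihSum c) (k + 1)]
    congr 1
    push_cast
    rw [add_smul ((k : ℚ) + 1) 1, one_smul, add_comm]

/-- Together with `expAnnih_mul_X` this determines `expAnnih c`: it fixes scalars and turns
multiplication by a_{-n} into multiplication by a_{-n} + c_n. -/
theorem expAnnih_C (c : ℕ+ → A) (r : A) :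
    expAnnih c (MvPolynomial.C r) = MvPolynomial.C r := by
  change ∑ᶠ k : ℕ, ((k ! : ℕ) : ℚ)⁻¹ • (annihSum c ^ k) (MvPolynomial.C r) = _
  rw [finsum_eq_single _ 0]
  · simp
  · intro k hk
    obtain ⟨j, rfl⟩ := Nat.exists_eq_succ_of_ne_zero hk
    rw [Nat.succ_eq_add_one, pow_succ, Module.End.mul_apply, annihSum_C, map_zero, smul_zero]

/-- This is e^D a e^{-D} = a + [D, a] for a scalar commutator [D, a] = c_n, checked on finite
truncations of the exponential series. -/
theorem expAnnih_mul_X (c : ℕ+ → A) (v : Fock A) (n : ℕ+) :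
    expAnnih c (v * MvPolynomial.X n)
      = expAnnih c v * (MvPolynomial.X n + MvPolynomial.C (c n)) := by
  obtain ⟨m, hm⟩ := annihSum_locally_nilpotent c v
  have hsum : ∀ (w : Fock A) (M : ℕ), (∀ k, M ≤ k → (annihSum c ^ k) w = 0) →
      expAnnih c w = ∑ k ∈ Finset.range M, ((k ! : ℕ) : ℚ)⁻¹ • (annihSum c ^ k) w := by
    intro w M hM
    refine finsum_eq_sum_of_support_subset _ fun k hk => ?_
    by_contra h
    exact hk (by simp only [Finset.coe_range, Set.mem_Iio, not_lt] at h; simp [hM k h])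
  have hvX : ∀ k, m + 1 ≤ k → (annihSum c ^ k) (v * MvPolynomial.X n) = 0 := by
    intro k hk
    obtain ⟨j, rfl⟩ := Nat.exists_eq_add_of_le' (le_trans (Nat.le_add_left 1 m) hk)
    rw [annihSum_pow_mul_X, hm _ (by omega), hm _ (by omega), zero_mul, smul_zero, smul_zero,
      add_zero]
  have hfac : ∀ (k : ℕ) (w : Fock A), (((k + 1)! : ℕ) : ℚ)⁻¹ • ((k + 1 : ℕ) : ℚ) • w
      = ((k ! : ℕ) : ℚ)⁻¹ • w := by
    intro k w
    rw [smul_smul]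
    congr 1
    rw [Nat.factorial_succ]
    push_cast
    have : (k : ℚ) + 1 ≠ 0 := by positivity
    have : ((k ! : ℕ) : ℚ) ≠ 0 := by positivity
    field_simp
  rw [hsum _ (m + 1) hvX, mul_add, Finset.sum_range_succ']
  have h1 : expAnnih c v * MvPolynomial.C (c n)
      = ∑ k ∈ Finset.range m, ((k ! : ℕ) : ℚ)⁻¹ • c n • (annihSum c ^ k) v := by
    rw [hsum v m hm, Finset.sum_mul]
    refine Finset.sum_congr rfl fun k _ => ?_
    rw [smul_mul_assoc, MvPolynomial.smul_eq_C_mul (_ : Fock A) (c n), mul_comm (MvPolynomial.C _)]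
  have h2 : expAnnih c v * MvPolynomial.X n
      = ∑ k ∈ Finset.range (m + 1),
        ((k ! : ℕ) : ℚ)⁻¹ • ((annihSum c ^ k) v * MvPolynomial.X n) := by
    rw [hsum v (m + 1) fun k hk => hm k (by omega), Finset.sum_mul]
    exact Finset.sum_congr rfl fun k _ => smul_mul_assoc _ _ _
  rw [h1, h2, Finset.sum_range_succ' _ m]
  simp only [annihSum_pow_mul_X, smul_add, hfac, Finset.sum_add_distrib, pow_zero,
    Module.End.one_apply]
  ring

theorem expAnnih_apply (c : ℕ+ → A) (v : Fock A) : expAnnih c v = translate c v := by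
  induction v using MvPolynomial.induction_on with
  | C r => rw [expAnnih_C, translate, MvPolynomial.aeval_C]; rfl
  | add p q hp hq => rw [map_add, map_add, hp, hq]
  | mul_X p n hp => rw [expAnnih_mul_X, hp, map_mul, translate, MvPolynomial.aeval_X]

end Heisenberg

section Operators

variable {K : Type*} [Field K] [CharZero K]

/-- The power sums `∑_i (x_i^n + x_i⁻¹^n)`. -/
def powerSumPM {N : ℕ} (x : Fin N → K) (n : ℕ+) : K :=
  ∑ i, (x i ^ (n : ℕ) + (x i)⁻¹ ^ (n : ℕ))

theorem GammaPlus_apply {N : ℕ} (x : Fin N → K) (v : Fock K) :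
    GammaPlus x v = translate (powerSumPM x) v := by
  induction N with
  | zero =>
    have : powerSumPM x = 0 := by ext n; simp [powerSumPM]
    simp [GammaPlus, this, translate_zero]
  | succ N ih =>
    have h : GammaPlus x = halfVertex (x 0) * halfVertex (x 0)⁻¹ * GammaPlus (fun i => x i.succ) := by
      simp [GammaPlus, List.ofFn_succ]
    rw [h, Module.End.mul_apply, Module.End.mul_apply, ih, halfVertex, halfVertex, expAnnih_apply,
      expAnnih_apply, translate_translate, translate_translate]
    congr 2
    ext n
    simp [powerSumPM, Fin.sum_univ_succ, add_assoc]

end Operators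

/-! ### Power series determined by their logarithmic derivative -/

section PowerSeriesODE

/-- A power series over an algebra over a field of characteristic zero is determined by its
constant coefficient and its logarithmic derivative. -/
theorem powerSeries_eq_of_derivative_eq_mul {K R : Type*} [Field K] [CharZero K] [CommRing R]
    [Algebra K R] (F G P : R⟦X⟧) (hF : PowerSeries.derivative R F = F * P)
    (hG : PowerSeries.derivative R G = G * P)
    (h0 : PowerSeries.constantCoeff F = PowerSeries.constantCoeff G) : F = G := by
  have main : ∀ n, ∀ k ≤ n, PowerSeries.coeff k F = PowerSeries.coeff k G := by
    intro n
    induction n with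
    | zero =>
      intro k hk
      obtain rfl : k = 0 := by omega
      simpa using h0
    | succ n ih =>
      intro k hk
      rcases Nat.lt_or_eq_of_le hk with h | rfl
      · exact ih k (by omega)
      · have h1 := congrArg (PowerSeries.coeff n) hF
        have h2 := congrArg (PowerSeries.coeff n) hG
        rw [PowerSeries.coeff_derivative, PowerSeries.coeff_mul] at h1 h2
        have h3 : PowerSeries.coeff (n + 1) F * ((n : R) + 1)
            = PowerSeries.coeff (n + 1) G * ((n : R) + 1) := by
          rw [h1, h2]
          refine Finset.sum_congr rfl fun p hp => ?_
          rw [ih p.1 (by have := Finset.HasAntidiagonal.mem_antidiagonal.1 hp; omega)]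
        -- R may have zero divisors; invertibility of n + 1 is inherited from the field K of
        -- characteristic zero.
        have hu : IsUnit ((n : R) + 1) := by
          have : IsUnit ((n : K) + 1) := IsUnit.mk0 _ (Nat.cast_add_one_ne_zero n)
          simpa using this.map (algebraMap K R)
        exact hu.mul_right_cancel h3
  ext n
  exact main n n le_rfl

end PowerSeriesODE

/-! ### The series H(z) under substitutions in the Fock space -/

section VertexOperators

variable {K : Type*} [Field K] [CharZero K]

theorem hasSubst_createPart (s : ℚ) : PowerSeries.HasSubst (PowerSeries.mk fun n : ℕ =>
    if h : 0 < n then (s / n) • (MvPolynomial.X (⟨n, h⟩ : ℕ+) : Fock K) else 0) :=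
  PowerSeries.HasSubst.of_constantCoeff_zero' (by simp)

theorem constantCoeff_createPart (s : ℚ) :
    PowerSeries.constantCoeff (createPart s : (Fock K)⟦X⟧) = 1 := by
  rw [← PowerSeries.coeff_zero_eq_constantCoeff_apply, createPart,
    PowerSeries.coeff_subst' (hasSubst_createPart s), finsum_eq_single _ 0]
  · simp
  · intro d hd
    rw [PowerSeries.coeff_zero_eq_constantCoeff_apply, map_pow]
    simp [hd]

theorem derivative_createPart (s : ℚ) :
    PowerSeries.derivative (Fock K) (createPart s) =
      createPart s * PowerSeries.mk fun n : ℕ => s • (MvPolynomial.X n.succPNat : Fock K) := by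
  rw [createPart, PowerSeries.derivative_subst (hasSubst_createPart s), PowerSeries.derivative_exp]
  congr 1
  ext1 n
  rw [PowerSeries.coeff_derivative, PowerSeries.coeff_mk, PowerSeries.coeff_mk,
    dif_pos n.succ_pos]
  have h : (n : Fock K) + 1 = algebraMap ℚ (Fock K) ((n : ℚ) + 1) := by simp
  rw [h, mul_comm, ← Algebra.smul_def, smul_smul]
  congr 1
  have : (n : ℚ) + 1 ≠ 0 := by positivity
  push_cast
  field_simp

theorem createPart_neg_mul : (createPart (-1) * createPart 1 : (Fock K)⟦X⟧) = 1 := by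
  refine powerSeries_eq_of_derivative_eq_mul (K := K) _ _ 0 ?_ ?_ ?_
  · rw [Derivation.leibniz, derivative_createPart, derivative_createPart, smul_eq_mul, smul_eq_mul]
    have : (PowerSeries.mk fun n : ℕ => (-1 : ℚ) • (MvPolynomial.X n.succPNat : Fock K))
        = - PowerSeries.mk fun n : ℕ => (1 : ℚ) • (MvPolynomial.X n.succPNat : Fock K) := by
      ext1 n; simp
    rw [this]
    ring
  · simp
  · simp [constantCoeff_createPart]

theorem derivative_map_createPart {R : Type*} [CommRing R] [Algebra K R] (h : Fock K →ₐ[K] R) :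
    PowerSeries.derivative R (PowerSeries.map (h : Fock K →+* R) (createPart 1))
      = PowerSeries.map (h : Fock K →+* R) (createPart 1) *
        PowerSeries.mk fun n : ℕ => h (MvPolynomial.X n.succPNat) := by
  have h1 : PowerSeries.derivative R (PowerSeries.map (h : Fock K →+* R) (createPart 1))
      = PowerSeries.map (h : Fock K →+* R) (PowerSeries.derivative (Fock K) (createPart 1)) := by
    ext n
    simp [PowerSeries.coeff_derivative]
  rw [h1, derivative_createPart, map_mul]
  congr 1
  ext n
  simp

theorem constantCoeff_map_createPart {R : Type*} [CommRing R] (h : Fock K →+* R) (s : ℚ) :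
    PowerSeries.constantCoeff (PowerSeries.map h (createPart s)) = 1 := by
  rw [← PowerSeries.coeff_zero_eq_constantCoeff_apply, PowerSeries.coeff_map,
    PowerSeries.coeff_zero_eq_constantCoeff_apply, constantCoeff_createPart, map_one]

/-- Adding uⁿ + vⁿ to the power sums multiplies H(z) by exp(∑ (uⁿ + vⁿ) zⁿ / n) = 1 / ((1 - u z)(1 -
v z)). Comparing logarithmic derivatives proves it without a formal logarithm. The same fact serves
for (u, v) = (T, T⁻¹), (w_i, w_i⁻¹) and (x_i, x_i⁻¹). -/
theorem quadSeries_mul_map_createPart {R : Type*} [CommRing R] [Algebra K R]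
    (f g : Fock K →ₐ[K] R) (u v : R) (huv : u * v = 1)
    (hfg : ∀ n : ℕ+, f (MvPolynomial.X n) = g (MvPolynomial.X n) + (u ^ (n : ℕ) + v ^ (n : ℕ))) :
    quadSeries (u + v) * PowerSeries.map (f : Fock K →+* R) (createPart 1)
      = PowerSeries.map (g : Fock K →+* R) (createPart 1) := by
  have hgeom : ∀ w : R, (1 - PowerSeries.C w * PowerSeries.X) *
      (PowerSeries.mk fun n : ℕ => w ^ (n + 1)) = PowerSeries.C w := by
    intro w
    ext n
    rw [sub_mul, one_mul, map_sub, mul_assoc, PowerSeries.coeff_C_mul, PowerSeries.coeff_mk]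
    cases n with
    | zero => simp
    | succ n => simp [PowerSeries.coeff_succ_X_mul, pow_succ]; ring
  have hq : quadSeries (u + v) = (1 - PowerSeries.C u * PowerSeries.X) *
      (1 - PowerSeries.C v * PowerSeries.X) := by
    have : (PowerSeries.C u * PowerSeries.C v : R⟦X⟧) = 1 := by rw [← map_mul, huv, map_one]
    rw [quadSeries, map_add]
    linear_combination (-PowerSeries.X ^ 2) * this
  refine powerSeries_eq_of_derivative_eq_mul (K := K) _ _
    (PowerSeries.mk fun n : ℕ => g (MvPolynomial.X n.succPNat)) ?_ (derivative_map_createPart g) ?_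
  · have hP : (PowerSeries.mk fun n : ℕ => f (MvPolynomial.X n.succPNat))
        = (PowerSeries.mk fun n : ℕ => g (MvPolynomial.X n.succPNat))
          + (PowerSeries.mk fun n : ℕ => u ^ (n + 1)) + (PowerSeries.mk fun n : ℕ => v ^ (n + 1)) := by
      ext n
      simp [hfg, add_assoc]
    have hdq : PowerSeries.derivative R (quadSeries (u + v))
        = - PowerSeries.C u * (1 - PowerSeries.C v * PowerSeries.X)
          - PowerSeries.C v * (1 - PowerSeries.C u * PowerSeries.X) := by
      rw [hq, Derivation.leibniz]
      simp
      ring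
    rw [Derivation.leibniz, derivative_map_createPart f, hP, hdq, smul_eq_mul, smul_eq_mul, hq]
    linear_combination
      (PowerSeries.map (f : Fock K →+* R) (createPart 1)) *
        ((1 - PowerSeries.C v * PowerSeries.X) * hgeom u +
        (1 - PowerSeries.C u * PowerSeries.X) * hgeom v)
  · rw [map_mul, constantCoeff_map_createPart, constantCoeff_map_createPart]
    simp [quadSeries]

theorem map_createPart_of_X_eq_zero {R : Type*} [CommRing R] [Algebra K R] (f : Fock K →ₐ[K] R)
    (hf : ∀ n : ℕ+, f (MvPolynomial.X n) = 0) :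
    PowerSeries.map (f : Fock K →+* R) (createPart 1) = 1 := by
  refine powerSeries_eq_of_derivative_eq_mul (K := K) _ _ 0 ?_ (by simp) ?_
  · rw [derivative_map_createPart]
    congr 1
    ext n
    simp [hf]
  · rw [constantCoeff_map_createPart, map_one]

theorem prod_quadSeries_mul_map_createPart {R ι : Type*} [CommRing R] [Algebra K R]
    (s : Finset ι) (f g : Fock K →ₐ[K] R) (u v : ι → R) (huv : ∀ i, u i * v i = 1)
    (hfg : ∀ n : ℕ+, f (MvPolynomial.X n) =
      g (MvPolynomial.X n) + ∑ i ∈ s, (u i ^ (n : ℕ) + v i ^ (n : ℕ))) :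
    (∏ i ∈ s, quadSeries (u i + v i)) * PowerSeries.map (f : Fock K →+* R) (createPart 1)
      = PowerSeries.map (g : Fock K →+* R) (createPart 1) := by
  classical
  induction s using Finset.induction_on generalizing f with
  | empty =>
    have : f = g := MvPolynomial.algHom_ext fun n => by simpa using hfg n
    simp [this]
  | insert a s ha ih =>
    -- The homomorphism is changed one pair (u_i, v_i) at a time; `f'` differs from `f` by the pair
    -- a alone.
    set f' : Fock K →ₐ[K] R := MvPolynomial.aeval fun n : ℕ+ =>
      g (MvPolynomial.X n) + ∑ i ∈ s, (u i ^ (n : ℕ) + v i ^ (n : ℕ)) with hf'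
    rw [Finset.prod_insert ha, mul_comm (quadSeries _), mul_assoc,
      quadSeries_mul_map_createPart f f' _ _ (huv a) fun n => ?_]
    · exact ih f' fun n => by rw [hf', MvPolynomial.aeval_X]
    · rw [hfg, Finset.sum_insert ha, hf', MvPolynomial.aeval_X]
      ring

end VertexOperators

/-! ### Coefficients of products with Laurent polynomials; adding a row to the determinant -/

section LaurentPairing

variable {A : Type*} [CommRing A]

/-- The coefficient of `z^n` in the product of `∑ e_m z^m` with a Laurent polynomial. -/
def laurentPairing (e : ℤ → A) (n : ℤ) : A[T;T⁻¹] →ₗ[A] A where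
  toFun F := F.coeff.sum fun k a => a * e (n - k)
  map_add' F G := by
    rw [AddMonoidAlgebra.coeff_add]
    exact Finsupp.sum_add_index' (by simp) (by intros; ring)
  map_smul' r F := by
    rw [AddMonoidAlgebra.coeff_smul, Finsupp.sum_smul_index' (by simp), RingHom.id_apply,
      Finsupp.smul_sum]
    simp [mul_assoc]

theorem laurentPairing_T (e : ℤ → A) (n k : ℤ) :
    laurentPairing e n (LaurentPolynomial.T k) = e (n - k) := by
  change (AddMonoidAlgebra.single k (1 : A)).coeff.sum (fun k a => a * e (n - k)) = _
  rw [AddMonoidAlgebra.coeff_single, Finsupp.sum_single_index (by simp), one_mul]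

theorem laurentPairing_C_mul (e : ℤ → A) (n : ℤ) (a : A) (F : A[T;T⁻¹]) :
    laurentPairing e n (LaurentPolynomial.C a * F) = a * laurentPairing e n F := by
  rw [← LaurentPolynomial.smul_eq_C_mul, map_smul, smul_eq_mul]

theorem laurentPairing_T_mul (e : ℤ → A) (n k : ℤ) (F : A[T;T⁻¹]) :
    laurentPairing e n (LaurentPolynomial.T k * F) = laurentPairing e (n - k) F := by
  induction F using LaurentPolynomial.induction_on' with
  | add p q hp hq => rw [mul_add, map_add, map_add, hp, hq]
  | C_mul_T m a =>
    rw [mul_left_comm, laurentPairing_C_mul, laurentPairing_C_mul, ← LaurentPolynomial.T_add,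
      laurentPairing_T, laurentPairing_T, sub_sub]

theorem laurentPairing_pow (e : ℤ → A) (n : ℤ) (j : ℕ) :
    laurentPairing e n ((LaurentPolynomial.T 1 + LaurentPolynomial.T (-1)) ^ j)
      = coeffFunctional e n (Polynomial.X ^ j) := by
  induction j generalizing n with
  | zero =>
    rw [pow_zero, pow_zero, ← LaurentPolynomial.T_zero, laurentPairing_T, coeffFunctional_one,
      sub_zero]
  | succ j ih =>
    rw [pow_succ', pow_succ', add_mul, map_add, laurentPairing_T_mul, laurentPairing_T_mul, ih, ih,
      coeffFunctional_mul, coeffFunctional_X, sub_neg_eq_add]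

/-- The determinant whose first row consists of the powers of `t`, the other rows being
functionals on polynomials, is a determinant with one row less. -/
theorem det_cons_pow {R : Type*} [CommRing R] {n : ℕ} (t : R)
    (L : Fin n → Polynomial R →ₗ[R] R) :
    (Matrix.of fun i j : Fin (n + 1) =>
      (Fin.cons (Polynomial.leval t) L : Fin (n + 1) → Polynomial R →ₗ[R] R) i
        (Polynomial.X ^ (j : ℕ))).det =
    (Matrix.of fun i j : Fin n =>
      L i ((Polynomial.X - Polynomial.C t) * Polynomial.X ^ (j : ℕ))).det := by
  nontriviality R
  set L' : Fin (n + 1) → Polynomial R →ₗ[R] R := Fin.cons (Polynomial.leval t) L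
  set q : Fin (n + 1) → Polynomial R := Fin.cons 1 fun j : Fin n =>
    (Polynomial.X - Polynomial.C t) * Polynomial.X ^ (j : ℕ) with hq
  have hd : ∀ j, (q j).natDegree ≤ j := by
    intro j
    induction j using Fin.cases with
    | zero => simp [hq]
    | succ j =>
      rw [hq, Fin.cons_succ]
      refine Polynomial.natDegree_mul_le.trans ?_
      simp [add_comm]
  have hc : ∀ j, (q j).coeff j = 1 := by
    intro j
    induction j using Fin.cases with
    | zero => simp [hq]
    | succ j =>
      rw [hq, Fin.cons_succ, Fin.val_succ, Polynomial.coeff_mul_X_pow', if_pos (by omega)]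
      simp [Polynomial.coeff_X]
  have h := det_functional_eq L' q fun j => (hd j).trans_lt j.2
  rw [det_coeff_unitriangular q hd hc, mul_one] at h
  -- In the basis 1, (X - t) X^j the row of evaluations at t is (1, 0, …, 0), so the expansion along
  -- it has a single term.
  rw [← h, Matrix.det_succ_row_zero, Finset.sum_eq_single 0]
  · simp only [Matrix.of_apply, Fin.val_zero, pow_zero, one_mul]
    have : L' 0 (q 0) = 1 := by simp [L', hq]
    rw [this, one_mul]
    congr 1
  · intro j _ hj
    obtain ⟨j, rfl⟩ := Fin.exists_succ_eq.2 hj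
    have : L' 0 (q j.succ) = 0 := by simp [L', hq]
    rw [Matrix.of_apply, this]
    simp
  · simp

/-- The hypothesis says that f turns the series of H into z (z + z⁻¹ - t) times that of H'. The
factor z is the shift to n - 1, and the rest is the polynomial X - t. -/
theorem map_coeffFunctional_onePlus {R S : Type*} [CommRing R] [CommRing S] (f : R →+* S)
    (H : ℤ → R) (H' : ℤ → S) (t : S)
    (h : ∀ n, f (H n) = H' n - t * H' (n - 1) + H' (n - 2)) (n : ℤ) (j : ℕ) :
    f (coeffFunctional (onePlus H) n (Polynomial.X ^ j)) =
      coeffFunctional (onePlus H') (n - 1)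
        ((Polynomial.X - Polynomial.C t) * Polynomial.X ^ j) := by
  have h2 : ∀ n, f (onePlus H n)
      = coeffFunctional (onePlus H') (n + -1) (Polynomial.X - Polynomial.C t) := by
    intro n
    rw [coeffFunctional_X_sub_C, onePlus, map_add, h, h]
    simp only [onePlus]
    rw [show n - 1 - 2 = n + -1 - 1 - 1 by ring, show n - 2 = n + -1 - 1 by ring,
      show n + -1 + 1 - 1 = n - 1 by ring, show n + -1 + 1 = n by ring,
      show n - 1 - 1 = n + -1 - 1 by ring, show n + -1 = n - 1 by ring]
    ring
  rw [map_coeffFunctional, mul_comm (Polynomial.X - Polynomial.C t), coeffFunctional_mul,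
    Polynomial.map_pow, Polynomial.map_X, sub_eq_add_neg n 1,
    ← coeffFunctional_shift (fun n => coeffFunctional (onePlus H') n _)]
  simp only [h2]

end LaurentPairing

/-! ### The ket as a determinant -/

section VertexCoeff

variable {K : Type*} [Field K]

theorem zUnit_zpow (n : ℤ) :
    ((zUnit (K := K) ^ n : ((Fock K)⸨X⸩)ˣ) : (Fock K)⸨X⸩) = HahnSeries.single n 1 := by
  have hpos : ∀ n : ℕ, ((zUnit (K := K) ^ n : ((Fock K)⸨X⸩)ˣ) : (Fock K)⸨X⸩)
      = HahnSeries.single (n : ℤ) 1 := by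
    intro n
    rw [Units.val_pow_eq_pow_val]
    change (HahnSeries.single (1 : ℤ) (1 : Fock K)) ^ n = _
    rw [HahnSeries.single_pow]
    simp
  have hneg : ∀ n : ℕ, (((zUnit (K := K))⁻¹ ^ n : ((Fock K)⸨X⸩)ˣ) : (Fock K)⸨X⸩)
      = HahnSeries.single (-n : ℤ) 1 := by
    intro n
    rw [Units.val_pow_eq_pow_val]
    change (HahnSeries.single (-1 : ℤ) (1 : Fock K)) ^ n = _
    rw [HahnSeries.single_pow]
    simp
  rcases Int.eq_nat_or_neg n with ⟨n, rfl | rfl⟩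
  · rw [zpow_natCast]; exact hpos n
  · rw [zpow_neg, zpow_natCast, ← inv_pow]; exact hneg n

/-- Laurent polynomials as Laurent series. -/
def laurentToSeries : (Fock K)[T;T⁻¹] →+* (Fock K)⸨X⸩ :=
  LaurentPolynomial.eval₂ HahnSeries.C zUnit

theorem laurentToSeries_C_mul_T (a : Fock K) (n : ℤ) :
    laurentToSeries (LaurentPolynomial.C a * LaurentPolynomial.T n) = HahnSeries.single n a := by
  rw [laurentToSeries, LaurentPolynomial.eval₂_C_mul_T, zUnit_zpow, HahnSeries.C_apply,
    HahnSeries.single_mul_single, zero_add, mul_one]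

variable [CharZero K]

/-- The substitution `a_{-n} ↦ a_{-n} + s (z^n + z^{-n})`. -/
def twist (s : ℚ) : Fock K →ₐ[K] (Fock K)[T;T⁻¹] :=
  MvPolynomial.aeval fun n : ℕ+ => LaurentPolynomial.C (MvPolynomial.X n) +
    s • (LaurentPolynomial.T (n : ℤ) + LaurentPolynomial.T (-(n : ℤ)))

theorem annihPart_eq (s : ℚ) (v : Fock K) : annihPart s v = laurentToSeries (twist s v) := by
  rw [annihPart, expAnnih_apply]
  induction v using MvPolynomial.induction_on with
  | C r =>
    simp [translate, toSeries, twist, laurentToSeries, MvPolynomial.algebraMap_eq,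
      LaurentPolynomial.algebraMap_apply]
  | add p q hp hq => simp only [map_add, hp, hq]
  | mul_X p n hp =>
    simp only [map_mul, hp]
    congr 1
    rw [MvPolynomial.map_X, translate, twist, MvPolynomial.aeval_X, MvPolynomial.aeval_X]
    have h : ∀ k : ℤ, toSeries (s • MvPolynomial.C (LaurentPolynomial.T k))
        = s • (LaurentPolynomial.eval₂ (HahnSeries.C : Fock K →+* (Fock K)⸨X⸩) zUnit)
          (LaurentPolynomial.T k) := by
      intro k
      rw [map_rat_smul]
      simp [toSeries]
    simp only [map_add, smul_add, h, map_rat_smul, laurentToSeries,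
      LaurentPolynomial.eval₂_C]
    simp [toSeries]

theorem ofPowerSeries_coeff {R : Type*} [CommRing R] (F : R⟦X⟧) (n : ℤ) :
    (HahnSeries.ofPowerSeries ℤ R F).coeff n = powerSeriesSeq F n := by
  rcases lt_or_ge n 0 with h | h
  · rw [powerSeriesSeq_of_neg F h]
    rw [PowerSeries.coeff_coe, if_pos h]
  · lift n to ℕ using h
    rw [powerSeriesSeq_natCast]
    exact HahnSeries.ofPowerSeries_apply_coeff F n

theorem vertexCoeff_apply (s : ℚ) (n : ℤ) (v : Fock K) :
    vertexCoeff s n v = laurentPairing (fun m => powerSeriesSeq (createPart s) m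
      + s • powerSeriesSeq (createPart s) (m - 1)) n (twist (-s) v) := by
  change (vertexSeries s v).coeff n = _
  rw [vertexSeries, annihPart_eq]
  induction twist (-s) v using LaurentPolynomial.induction_on' with
  | add p q hp hq => rw [map_add, mul_add, HahnSeries.coeff_add, hp, hq, map_add]
  | C_mul_T m a =>
    rw [laurentToSeries_C_mul_T, HahnSeries.coeff_mul_single, laurentPairing_C_mul,
      laurentPairing_T, mul_comm a, add_mul, one_mul, HahnSeries.coeff_add]
    have h : s • HahnSeries.single (1 : ℤ) (1 : Fock K) = HahnSeries.single 1 (s • 1) := by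
      ext1
      ext1 k
      rw [HahnSeries.coeff_smul]
      simp only [HahnSeries.coeff_single]
      split_ifs <;> simp
    rw [ofPowerSeries_coeff, h, HahnSeries.coeff_single_mul, smul_one_mul, ofPowerSeries_coeff]

theorem quadSeries_mul_createPart :
    quadSeries (LaurentPolynomial.T 1 + LaurentPolynomial.T (-1)) *
      PowerSeries.map LaurentPolynomial.C (createPart 1 : (Fock K)⟦X⟧)
      = PowerSeries.map ((twist (-1) : Fock K →ₐ[K] (Fock K)[T;T⁻¹]) : Fock K →+* (Fock K)[T;T⁻¹]) (createPart 1) := by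
  refine quadSeries_mul_map_createPart
    (IsScalarTower.toAlgHom K (Fock K) (Fock K)[T;T⁻¹]) (twist (-1)) _ _ ?_ ?_
  · rw [← LaurentPolynomial.T_add]; simp
  · intro n
    rw [LaurentPolynomial.T_pow, LaurentPolynomial.T_pow]
    simp [twist, LaurentPolynomial.algebraMap_apply]
    abel

/-- Induction on the number of operators. The substitution inside the leftmost U is a ring
homomorphism, so it acts entrywise on the smaller determinant and inserts the factor X - t in every
entry. By `det_cons_pow` this is a determinant with an extra row of powers of t, and taking the
coefficient against (1 + z) H(z) turns that row into the missing one. -/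
theorem prod_U_apply_one (m : ℕ) (lam : Fin m → ℤ) :
    (List.ofFn fun i => (U (-(lam i)) : Module.End K (Fock K))).prod 1 =
      (Matrix.of fun i j : Fin m => coeffFunctional (onePlus (powerSeriesSeq (createPart 1)))
        (lam i - (i : ℕ)) (Polynomial.X ^ (j : ℕ))).det := by
  induction m with
  | zero => simp
  | succ m ih =>
    set H : ℤ → Fock K := powerSeriesSeq (createPart 1)
    rw [List.ofFn_succ, List.prod_cons, Module.End.mul_apply, ih fun i => lam i.succ]
    rw [U, neg_neg, vertexCoeff_apply]
    have he : (fun m => powerSeriesSeq (createPart 1) m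
      + (1 : ℚ) • powerSeriesSeq (createPart 1) (m - 1)) = onePlus H := by
      ext1 m; rw [one_smul]; rfl
    rw [he, AlgHom.map_det]
    set t : (Fock K)[T;T⁻¹] := LaurentPolynomial.T 1 + LaurentPolynomial.T (-1) with ht
    have h1 : (twist (-1) : Fock K →ₐ[K] _).mapMatrix (Matrix.of fun i j : Fin m =>
        coeffFunctional (onePlus H) (lam i.succ - (i : ℕ)) (Polynomial.X ^ (j : ℕ)))
        = Matrix.of fun i j : Fin m =>
          coeffFunctional (onePlus fun n => LaurentPolynomial.C (H n)) (lam i.succ - (i.succ : ℕ))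
          ((Polynomial.X - Polynomial.C t) * Polynomial.X ^ (j : ℕ)) := by
      ext1 i j
      -- Passing to one more operator raises the row number by one, which absorbs the shift n ↦ n -
      -- 1 of `map_coeffFunctional_onePlus`.
      rw [AlgHom.mapMatrix_apply, Matrix.map_apply, Matrix.of_apply, Matrix.of_apply,
        show lam i.succ - ((i.succ : ℕ) : ℤ) = lam i.succ - (i : ℕ) - 1 by
          rw [Fin.val_succ]; push_cast; ring]
      refine map_coeffFunctional_onePlus (twist (-1) : Fock K →ₐ[K] (Fock K)[T;T⁻¹]).toRingHom
        H _ t (fun n => ?_) _ _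
      simp only [H]
      rw [map_powerSeriesSeq, map_powerSeriesSeq, map_powerSeriesSeq, map_powerSeriesSeq,
        ← powerSeriesSeq_quadSeries_mul, quadSeries_mul_createPart]
      rfl
    rw [h1, ← det_cons_pow t fun i : Fin m =>
      coeffFunctional (onePlus fun n => LaurentPolynomial.C (H n)) (lam i.succ - (i.succ : ℕ)),
      Matrix.det_succ_row_zero, Matrix.det_succ_row_zero, map_sum]
    refine Finset.sum_congr rfl fun j _ => ?_
    -- The minors avoiding the first row are constant in z, so z enters each term of the expansion
    -- only through t^j.
    have h5 : ((Matrix.of fun i j : Fin (m + 1) =>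
        (Fin.cons (Polynomial.leval t) fun i : Fin m =>
          coeffFunctional (onePlus fun n => LaurentPolynomial.C (H n))
          (lam i.succ - (i.succ : ℕ)) : Fin (m + 1) → Polynomial _ →ₗ[_] _) i
            (Polynomial.X ^ (j : ℕ))).submatrix Fin.succ j.succAbove).det
        = LaurentPolynomial.C ((Matrix.of fun i j : Fin (m + 1) => coeffFunctional (onePlus H)
          (lam i - (i : ℕ)) (Polynomial.X ^ (j : ℕ))).submatrix Fin.succ j.succAbove).det := by
      rw [RingHom.map_det]
      congr 1
      ext1 i k
      simp only [Matrix.submatrix_apply, Matrix.of_apply, Fin.cons_succ, RingHom.mapMatrix_apply,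
        Matrix.map_apply, map_coeffFunctional, Polynomial.map_pow, Polynomial.map_X]
      congr 2
      ext1 n
      simp [onePlus]
    rw [h5]
    simp only [Matrix.of_apply, Fin.cons_zero, Polynomial.leval_apply, Polynomial.eval_pow,
      Polynomial.eval_X]
    rw [show ((-1 : (Fock K)[T;T⁻¹]) ^ (j : ℕ)) = LaurentPolynomial.C ((-1) ^ (j : ℕ)) by simp,
      mul_comm _ (LaurentPolynomial.C (Matrix.det _)), laurentPairing_C_mul, laurentPairing_C_mul,
      ht, laurentPairing_pow]
    simp
    ring

end VertexCoeff

/-! ### Coefficient extraction in Laurent polynomial rings -/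

section LaurentCoeff

variable {R : Type*} [CommRing R]

theorem coeff_mul_C_mul_T (E : R[T;T⁻¹]) (a : R) (n k : ℤ) :
    (E * (LaurentPolynomial.C a * LaurentPolynomial.T k)).coeff n = a * E.coeff (n - k) := by
  induction E using LaurentPolynomial.induction_on' with
  | add p q hp hq =>
    rw [add_mul, AddMonoidAlgebra.coeff_add, AddMonoidAlgebra.coeff_add, Finsupp.add_apply,
      Finsupp.add_apply, hp, hq, mul_add]
  | C_mul_T m b =>
    rw [mul_mul_mul_comm, ← map_mul, ← LaurentPolynomial.T_add,
      ← LaurentPolynomial.single_eq_C_mul_T, ← LaurentPolynomial.single_eq_C_mul_T,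
      AddMonoidAlgebra.coeff_single, AddMonoidAlgebra.coeff_single, Finsupp.single_apply,
      Finsupp.single_apply]
    have : m + k = n ↔ m = n - k := by omega
    simp only [this]
    split_ifs
    · ring
    · simp

theorem coeff_mul_T (E : R[T;T⁻¹]) (n k : ℤ) :
    (E * LaurentPolynomial.T k).coeff n = E.coeff (n - k) := by
  simpa using coeff_mul_C_mul_T E 1 n k

theorem coeff_C_mul (E : R[T;T⁻¹]) (a : R) (n : ℤ) :
    (LaurentPolynomial.C a * E).coeff n = a * E.coeff n := by
  rw [mul_comm]
  simpa using coeff_mul_C_mul_T E a n 0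

theorem laurentPairing_coeff (E F : R[T;T⁻¹]) (n : ℤ) :
    laurentPairing (fun m => E.coeff m) n F = (E * F).coeff n := by
  induction F using LaurentPolynomial.induction_on' with
  | add p q hp hq => rw [map_add, mul_add, AddMonoidAlgebra.coeff_add, Finsupp.add_apply, hp, hq]
  | C_mul_T m b => rw [laurentPairing_C_mul, laurentPairing_T, coeff_mul_C_mul_T]

theorem coeff_toLaurent_eq (p : Polynomial R) (n : ℤ) :
    (Polynomial.toLaurent p).coeff n = powerSeriesSeq (p : R⟦X⟧) n := by
  induction p using Polynomial.induction_on' with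
  | add p q hp hq =>
    rw [map_add, AddMonoidAlgebra.coeff_add, Finsupp.add_apply, hp, hq, Polynomial.coe_add,
      powerSeriesSeq_add]
  | monomial d a =>
    rw [← Polynomial.C_mul_X_pow_eq_monomial, Polynomial.toLaurent_C_mul_X_pow,
      ← LaurentPolynomial.single_eq_C_mul_T, AddMonoidAlgebra.coeff_single, Finsupp.single_apply]
    rcases lt_or_ge n 0 with h | h
    · rw [powerSeriesSeq_of_neg _ h, if_neg (by omega)]
    · lift n to ℕ using h
      rw [powerSeriesSeq_natCast]
      simp [eq_comm]

/-- The unit `T` of the ring of Laurent polynomials. -/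
def laurentUnit (R : Type*) [CommRing R] : (R[T;T⁻¹])ˣ where
  val := LaurentPolynomial.T 1
  inv := LaurentPolynomial.T (-1)
  val_inv := by rw [← LaurentPolynomial.T_add]; simp
  inv_val := by rw [← LaurentPolynomial.T_add]; simp

theorem laurentUnit_zpow (n : ℤ) :
    ((laurentUnit R ^ n : (R[T;T⁻¹])ˣ) : R[T;T⁻¹]) = LaurentPolynomial.T n := by
  have hinv : (((laurentUnit R)⁻¹ : (R[T;T⁻¹])ˣ) : R[T;T⁻¹]) = LaurentPolynomial.T (-1) := rfl
  rcases Int.eq_nat_or_neg n with ⟨n, rfl | rfl⟩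
  · rw [zpow_natCast, Units.val_pow_eq_pow_val]
    exact (LaurentPolynomial.T_pow 1 n).trans (by simp)
  · rw [zpow_neg, zpow_natCast, ← inv_pow, Units.val_pow_eq_pow_val, hinv,
      LaurentPolynomial.T_pow]
    simp

theorem map_laurentPairing {S : Type*} [CommRing S] (f : R →+* S) (e : ℤ → R) (n : ℤ)
    (F : R[T;T⁻¹]) :
    f (laurentPairing e n F) = laurentPairing (fun m => f (e m)) n
      (LaurentPolynomial.eval₂ (LaurentPolynomial.C.comp f) (laurentUnit S) F) := by
  induction F using LaurentPolynomial.induction_on' with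
  | add p q hp hq => simp only [map_add, hp, hq]
  | C_mul_T m b =>
    rw [laurentPairing_C_mul, laurentPairing_T, LaurentPolynomial.eval₂_C_mul_T, laurentUnit_zpow,
      RingHom.comp_apply, laurentPairing_C_mul, laurentPairing_T, map_mul]

theorem coeff_eval₂_laurentUnit {S : Type*} [CommRing S] [Algebra R S] (F : R[T;T⁻¹]) (n : ℤ) :
    (LaurentPolynomial.eval₂ (algebraMap R S[T;T⁻¹]) (laurentUnit S) F).coeff n
      = algebraMap R S (F.coeff n) := by
  induction F using LaurentPolynomial.induction_on' with
  | add p q hp hq =>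
    rw [map_add, AddMonoidAlgebra.coeff_add, AddMonoidAlgebra.coeff_add, Finsupp.add_apply,
      Finsupp.add_apply, hp, hq, map_add]
  | C_mul_T m b =>
    rw [LaurentPolynomial.eval₂_C_mul_T, laurentUnit_zpow, LaurentPolynomial.algebraMap_apply,
      ← LaurentPolynomial.single_eq_C_mul_T, ← LaurentPolynomial.single_eq_C_mul_T,
      AddMonoidAlgebra.coeff_single, AddMonoidAlgebra.coeff_single, Finsupp.single_apply,
      Finsupp.single_apply]
    split_ifs <;> simp

end LaurentCoeff

/-! ### The bra as an iterated coefficient -/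

section Bra

universe u

variable {K : Type u} [Field K]

/-- The factor `∏_i (1 - w_i) ∏_{i<j} (1 - w_i w_j) (1 - w_i / w_j)`. -/
def braWeight {R : Type*} [CommRing R] {l : ℕ} (w : Fin l → Rˣ) : R :=
  ∏ i, ((1 - (w i : R)) * ∏ j ∈ Finset.Ioi i,
    ((1 - (w i : R) * w j) * (1 - (w i : R) * ((w j)⁻¹ : Rˣ))))

/-- The substitution `a_{-n} ↦ ∑_i (w_i^n + w_i^{-n})`. -/
def evalPM {R : Type*} [CommRing R] [Algebra K R] {l : ℕ} (w : Fin l → Rˣ) : Fock K →ₐ[K] R :=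
  MvPolynomial.aeval fun n : ℕ+ => ∑ i, ((w i : R) ^ (n : ℕ) + (((w i)⁻¹ : Rˣ) : R) ^ (n : ℕ))

/-- The units `T, C w_0, C w_1, …` in the Laurent polynomial ring. -/
def consUnits {R : Type*} [CommRing R] {l : ℕ} (w : Fin l → Rˣ) : Fin (l + 1) → (R[T;T⁻¹])ˣ :=
  Fin.cons (laurentUnit R) fun i => Units.map (LaurentPolynomial.C : R →+* R[T;T⁻¹]) (w i)

theorem consUnits_zero {R : Type*} [CommRing R] {l : ℕ} (w : Fin l → Rˣ) :
    (consUnits w 0 : R[T;T⁻¹]) = LaurentPolynomial.T 1 := rfl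

theorem consUnits_zero_inv {R : Type*} [CommRing R] {l : ℕ} (w : Fin l → Rˣ) :
    (((consUnits w 0)⁻¹ : (R[T;T⁻¹])ˣ) : R[T;T⁻¹]) = LaurentPolynomial.T (-1) := rfl

theorem consUnits_succ {R : Type*} [CommRing R] {l : ℕ} (w : Fin l → Rˣ) (i : Fin l) :
    (consUnits w i.succ : R[T;T⁻¹]) = LaurentPolynomial.C (w i : R) := rfl

theorem consUnits_succ_inv {R : Type*} [CommRing R] {l : ℕ} (w : Fin l → Rˣ) (i : Fin l) :
    (((consUnits w i.succ)⁻¹ : (R[T;T⁻¹])ˣ) : R[T;T⁻¹])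
      = LaurentPolynomial.C (((w i)⁻¹ : Rˣ) : R) := rfl

theorem evalPM_X {R : Type*} [CommRing R] [Algebra K R] {l : ℕ} (w : Fin l → Rˣ) (n : ℕ+) :
    (evalPM w : Fock K →ₐ[K] R) (MvPolynomial.X n)
      = ∑ i, ((w i : R) ^ (n : ℕ) + (((w i)⁻¹ : Rˣ) : R) ^ (n : ℕ)) :=
  MvPolynomial.aeval_X _ _

/-- The functional `F ↦ c (F_n)` on Laurent polynomials. -/
def coeffThen {R : Type*} [CommRing R] [Algebra K R] (c : R →ₗ[K] K) (n : ℤ) :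
    R[T;T⁻¹] →ₗ[K] K where
  toFun F := c (F.coeff n)
  map_add' F G := by rw [AddMonoidAlgebra.coeff_add, Finsupp.add_apply, map_add]
  map_smul' r F := by
    rw [AddMonoidAlgebra.coeff_smul, Finsupp.smul_apply, map_smul, RingHom.id_apply]

theorem coeffThen_apply {R : Type*} [CommRing R] [Algebra K R] (c : R →ₗ[K] K) (n : ℤ)
    (F : R[T;T⁻¹]) : coeffThen c n F = c (F.coeff n) := rfl

variable [CharZero K]

/-- The series exp(-∑ a_{-n} zⁿ / n) is the inverse of H(z), so at a finite alphabet it becomes a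
polynomial in z. This keeps the bra inside Laurent polynomials. -/
theorem map_createPart_neg {R : Type*} [CommRing R] [Algebra K R] {l : ℕ} (w : Fin l → Rˣ) :
    PowerSeries.map (evalPM w : Fock K →ₐ[K] R).toRingHom (createPart (-1))
      = ∏ i, quadSeries ((w i : R) + ((w i)⁻¹ : Rˣ)) := by
  have h1 := congrArg (PowerSeries.map (evalPM w : Fock K →ₐ[K] R).toRingHom)
    (createPart_neg_mul (K := K))
  set g : Fock K →ₐ[K] R := MvPolynomial.aeval fun _ => 0 with hg
  have h2 := (prod_quadSeries_mul_map_createPart Finset.univ (evalPM w : Fock K →ₐ[K] R) g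
    (fun i => (w i : R)) (fun i => ((w i)⁻¹ : Rˣ)) (by simp) (by simp [evalPM, hg])).trans
    (map_createPart_of_X_eq_zero g (by simp [hg]))
  rw [map_mul, map_one] at h1
  exact left_inv_eq_right_inv h1 (by rw [mul_comm]; exact h2)

theorem twist_X (s : ℚ) (n : ℕ+) :
    (twist s : Fock K →ₐ[K] (Fock K)[T;T⁻¹]) (MvPolynomial.X n)
      = LaurentPolynomial.C (MvPolynomial.X n) +
        s • (LaurentPolynomial.T (n : ℤ) + LaurentPolynomial.T (-(n : ℤ))) :=
  MvPolynomial.aeval_X _ _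

/-- Translating by zⁿ + z⁻ⁿ and then evaluating at the letters w is evaluation at the alphabet
enlarged by the letter z. -/
theorem eval₂_twist_one {R : Type*} [CommRing R] [Algebra K R] {l : ℕ} (w : Fin l → Rˣ)
    (v : Fock K) :
    LaurentPolynomial.eval₂ (LaurentPolynomial.C.comp
      (evalPM w : Fock K →ₐ[K] R).toRingHom) (laurentUnit R) (twist 1 v)
      = evalPM (consUnits w) v := by
  have hT : ∀ n : ℕ, (LaurentPolynomial.T (n : ℤ) : R[T;T⁻¹]) = LaurentPolynomial.T 1 ^ n := by
    intro n; rw [LaurentPolynomial.T_pow, mul_one]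
  have hT' : ∀ n : ℕ, (LaurentPolynomial.T (-(n : ℤ)) : R[T;T⁻¹])
      = LaurentPolynomial.T (-1) ^ n := by
    intro n; rw [LaurentPolynomial.T_pow, mul_neg, mul_one]
  induction v using MvPolynomial.induction_on with
  | C r =>
    simp [twist, evalPM, MvPolynomial.algebraMap_eq, LaurentPolynomial.algebraMap_apply]
  | add p q hp hq => simp only [map_add, hp, hq]
  | mul_X p n hp =>
    rw [map_mul, map_mul, map_mul, hp]
    refine congrArg (fun x => evalPM (consUnits w) p * x) ?_
    rw [twist_X, one_smul, evalPM_X, RingHom.map_add, RingHom.map_add, LaurentPolynomial.eval₂_T,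
      LaurentPolynomial.eval₂_T, LaurentPolynomial.eval₂_C, laurentUnit_zpow, laurentUnit_zpow, hT,
      hT', Fin.sum_univ_succ, add_comm, consUnits_zero, consUnits_zero_inv]
    simp only [consUnits_succ, consUnits_succ_inv, RingHom.comp_apply]
    congr 1
    exact (congrArg LaurentPolynomial.C (evalPM_X w n)).trans (by
      simp only [map_sum, map_add, map_pow])

theorem evalPM_vertexCoeff {R : Type*} [CommRing R] [Algebra K R] {l : ℕ} (w : Fin l → Rˣ)
    (n : ℤ) (v : Fock K) :
    evalPM w (vertexCoeff (-1) n v) = ((1 - LaurentPolynomial.T 1) *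
      (∏ j, ((1 - LaurentPolynomial.T 1 * LaurentPolynomial.C (w j : R)) *
        (1 - LaurentPolynomial.T 1 * LaurentPolynomial.C (((w j)⁻¹ : Rˣ) : R)))) *
      evalPM (consUnits w) v : R[T;T⁻¹]).coeff n := by
  have h1 : LaurentPolynomial.eval₂ (LaurentPolynomial.C.comp
      (evalPM w : Fock K →ₐ[K] R).toRingHom) (laurentUnit R) (twist 1 v)
      = evalPM (consUnits w) v := eval₂_twist_one w v
  have h2 : ∀ m, (evalPM w : Fock K →ₐ[K] R).toRingHom (powerSeriesSeq (createPart (-1)) m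
      + (-1 : ℚ) • powerSeriesSeq (createPart (-1)) (m - 1))
      = ((1 - LaurentPolynomial.T 1) *
      (∏ j, ((1 - LaurentPolynomial.T 1 * LaurentPolynomial.C (w j : R)) *
        (1 - LaurentPolynomial.T 1 * LaurentPolynomial.C (((w j)⁻¹ : Rˣ) : R)))) :
        R[T;T⁻¹]).coeff m := by
    intro m
    have h3 : (∏ j, ((1 - LaurentPolynomial.T 1 * LaurentPolynomial.C (w j : R)) *
        (1 - LaurentPolynomial.T 1 * LaurentPolynomial.C (((w j)⁻¹ : Rˣ) : R))))
        = Polynomial.toLaurent (∏ j, (1 - Polynomial.C ((w j : R) + ((w j)⁻¹ : Rˣ)) * Polynomial.X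
          + Polynomial.X ^ 2)) := by
      rw [map_prod]
      refine Finset.prod_congr rfl fun j _ => ?_
      have h : (LaurentPolynomial.C (w j : R) * LaurentPolynomial.C (((w j)⁻¹ : Rˣ) : R) : R[T;T⁻¹])
          = 1 := by rw [← map_mul, Units.mul_inv, map_one]
      rw [map_add, map_sub, map_one, map_mul, map_pow, Polynomial.toLaurent_X,
        Polynomial.toLaurent_C, map_add]
      linear_combination LaurentPolynomial.T 1 ^ 2 * h
    have h4 : ((∏ j, (1 - Polynomial.C ((w j : R) + ((w j)⁻¹ : Rˣ)) * Polynomial.X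
          + Polynomial.X ^ 2) : Polynomial R) : R⟦X⟧)
        = ∏ i, quadSeries ((w i : R) + ((w i)⁻¹ : Rˣ)) := by
      rw [← Polynomial.coeToPowerSeries.ringHom_apply, map_prod]
      simp [quadSeries]
    rw [neg_one_smul, ← sub_eq_add_neg, map_sub, map_powerSeriesSeq, map_powerSeriesSeq,
      map_createPart_neg, sub_mul, one_mul, AddMonoidAlgebra.coeff_sub, Finsupp.sub_apply, mul_comm,
      coeff_mul_T, h3, coeff_toLaurent_eq, coeff_toLaurent_eq, h4]
  rw [vertexCoeff_apply, neg_neg]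
  change (evalPM w : Fock K →ₐ[K] R).toRingHom _ = _
  rw [map_laurentPairing, h1]
  simp only [h2]
  rw [laurentPairing_coeff]

theorem braWeight_consUnits {R : Type*} [CommRing R] {l : ℕ} (w : Fin l → Rˣ) :
    braWeight (consUnits w) = LaurentPolynomial.C (braWeight w) * ((1 - LaurentPolynomial.T 1) *
      (∏ j, ((1 - LaurentPolynomial.T 1 * LaurentPolynomial.C (w j : R)) *
        (1 - LaurentPolynomial.T 1 * LaurentPolynomial.C (((w j)⁻¹ : Rˣ) : R))))) := by
  rw [braWeight, Fin.prod_univ_succ, Fin.Ioi_zero_eq_map, Finset.prod_map, mul_comm]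
  simp only [Fin.Ioi_succ, Finset.prod_map, Fin.coe_succEmb, consUnits_zero, consUnits_succ, consUnits_succ_inv, braWeight, map_prod,
    map_mul, map_sub, map_one]

/-- R is an iterated Laurent polynomial ring in the w_j and c extracts coefficients one variable at
a time. The second property, multiplicativity of c on products of one-variable factors, is what
allows c to be applied to a determinant column by column. -/
theorem exists_bra_eq (l : ℕ) (mu : Fin l → ℤ) :
    ∃ (R : Type u) (_ : CommRing R) (_ : Algebra K R) (w : Fin l → Rˣ) (c : R →ₗ[K] K),
      (∀ v : Fock K, vacuumDual
        ((List.ofFn fun j => (Ustar (-(mu j)) : Module.End K (Fock K))).reverse.prod v)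
          = c (braWeight w * evalPM w v)) ∧
      ∀ F : Fin l → K[T;T⁻¹], c (∏ j, LaurentPolynomial.eval₂ (algebraMap K R) (w j) (F j))
        = ∏ j, (F j).coeff (-(mu j)) := by
  induction l with
  | zero =>
    refine ⟨K, inferInstance, inferInstance, Fin.elim0, LinearMap.id, fun v => ?_, by simp⟩
    have : (evalPM (Fin.elim0 : Fin 0 → Kˣ) : Fock K →ₐ[K] K)
        = MvPolynomial.aeval (0 : ℕ+ → K) := by
      ext n; simp [evalPM]
    simp [vacuumDual_apply, braWeight, this]
  | succ l ih =>
    obtain ⟨R, _, _, w, c, h1, h2⟩ := ih fun j => mu j.succ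
    -- The operator for μ_1 acts first on v; its variable is the outermost one, and its coefficient
    -- is taken before c is applied.
    refine ⟨R[T;T⁻¹], inferInstance, inferInstance, consUnits w,
      coeffThen c (-(mu 0)),
      fun v => ?_, fun F => ?_⟩
    · rw [List.ofFn_succ, List.reverse_cons, List.prod_append, List.prod_singleton,
        Module.End.mul_apply, h1, coeffThen_apply, braWeight_consUnits, mul_assoc,
        coeff_C_mul, Ustar, evalPM_vertexCoeff]
    · have h3 : ∀ j : Fin l, LaurentPolynomial.eval₂ (algebraMap K R[T;T⁻¹])
          (consUnits w j.succ) (F j.succ)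
          = LaurentPolynomial.C (LaurentPolynomial.eval₂ (algebraMap K R) (w j) (F j.succ)) := by
        intro j
        induction F j.succ using LaurentPolynomial.induction_on' with
        | add p q hp hq => simp only [map_add, hp, hq]
        | C_mul_T m b =>
          rw [LaurentPolynomial.eval₂_C_mul_T, LaurentPolynomial.eval₂_C_mul_T, map_mul,
            LaurentPolynomial.algebraMap_apply]
          have h : consUnits w j.succ = Units.map (LaurentPolynomial.C : R →+* R[T;T⁻¹]) (w j) :=
            rfl
          rw [h, ← map_zpow, Units.coe_map, MonoidHom.coe_coe]
      rw [Fin.prod_univ_succ, Fin.prod_univ_succ, coeffThen_apply]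
      simp only [h3]
      rw [← map_prod, mul_comm, coeff_C_mul]
      have h4 : consUnits w 0 = laurentUnit R := rfl
      rw [h4, coeff_eval₂_laurentUnit, mul_comm, ← Algebra.smul_def, map_smul, h2, smul_eq_mul]

end Bra

/-! ### The Cauchy–Binet expansion of the first l columns -/

section CauchyBinet

theorem append_update_left {α : Type*} {l N : ℕ} (v : Fin l → α) (r : Fin N → α) (j : Fin l)
    (x : α) :
    Fin.append (Function.update v j x) r = Function.update (Fin.append v r) (Fin.castAdd N j) x := by
  ext i
  induction i using Fin.addCases with
  | left i =>
    rw [Fin.append_left]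
    by_cases h : i = j
    · subst h; simp
    · rw [Function.update_of_ne h, Function.update_of_ne (by simpa using h), Fin.append_left]
  | right i =>
    rw [Fin.append_right, Function.update_of_ne, Fin.append_right]
    intro h
    have := congrArg Fin.val h
    simp at this
    omega

/-- The determinant as an alternating function of the first `l` rows, the others being fixed. -/
def detAppend {R : Type*} [CommRing R] {l N : ℕ} (r : Fin N → Fin (l + N) → R) :
    (Fin (l + N) → R) [⋀^Fin l]→ₗ[R] R where
  toFun v := Matrix.detRowAlternating (Fin.append v r)
  map_update_add' v j x y := by
    rename_i inst
    -- The structure field allows any decidable equality on `Fin l`, while `append_update_left` uses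
    -- the canonical one.
    obtain rfl : inst = instDecidableEqFin l := Subsingleton.elim _ _
    simp only [append_update_left, AlternatingMap.map_update_add]
  map_update_smul' v j c x := by
    rename_i inst
    obtain rfl : inst = instDecidableEqFin l := Subsingleton.elim _ _
    simp only [append_update_left, AlternatingMap.map_update_smul]
  map_eq_zero_of_eq' v i j hv hij :=
    AlternatingMap.map_eq_zero_of_eq _ _ (i := Fin.castAdd N i) (j := Fin.castAdd N j)
      (by simpa using hv) (by simpa using hij)

theorem detAppend_apply {R : Type*} [CommRing R] {l N : ℕ} (r : Fin N → Fin (l + N) → R)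
    (v : Fin l → Fin (l + N) → R) :
    detAppend r v = (Matrix.of fun i j => (Fin.addCases (fun j => v j i) (fun j => r j i) j : R)).det := by
  rw [← Matrix.det_transpose]
  change Matrix.det (Fin.append v r) = _
  congr 1
  ext j i
  induction j using Fin.addCases <;> simp

/-- Every injective tuple is uniquely a strictly decreasing one composed with a permutation. -/
theorem sum_injective_eq {α M : Type*} [LinearOrder α] [Fintype α] [AddCommMonoid M] {l : ℕ}
    (F : (Fin l → α) → M) (hF : ∀ r, ¬ Function.Injective r → F r = 0) :
    ∑ r, F r = ∑ k : {k : Fin l → α // StrictAnti k}, ∑ σ : Equiv.Perm (Fin l), F (k.1 ∘ σ) := by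
  classical
  rw [← Finset.sum_product', ← Finset.sum_filter_of_ne (p := Function.Injective)
    fun r _ hr => by by_contra h; exact hr (hF r h)]
  symm
  refine Finset.sum_bij (fun p _ => p.1.1 ∘ p.2) ?_ ?_ ?_ ?_
  · intro p _
    simpa using p.1.2.injective.comp p.2.injective
  · rintro ⟨⟨k, hk⟩, σ⟩ _ ⟨⟨k', hk'⟩, σ'⟩ _ h
    simp only at h
    have hr : Set.range k = Set.range k' := by
      rw [← EquivLike.range_comp k σ, h, EquivLike.range_comp]
    have hkk : k = k' := by
      have h1 : StrictMono (OrderDual.toDual ∘ k) := fun _ _ hab => hk hab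
      have h2 : StrictMono (OrderDual.toDual ∘ k') := fun _ _ hab => hk' hab
      have := (h1.range_inj h2).1 (by rw [Set.range_comp, Set.range_comp, hr])
      exact this
    subst hkk
    have : σ = σ' := Equiv.ext fun i => hk.injective (congrFun h i)
    rw [this]
  · intro r hr
    have hr : Function.Injective r := by simpa using hr
    -- Sorting in the order dual produces a decreasing tuple.
    set τ := Tuple.sort (OrderDual.toDual ∘ r)
    have hm : Monotone ((OrderDual.toDual ∘ r) ∘ τ) := Tuple.monotone_sort _
    have hs : StrictMono ((OrderDual.toDual ∘ r) ∘ τ) :=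
      hm.strictMono_of_injective ((OrderDual.toDual.injective.comp hr).comp τ.injective)
    refine ⟨(⟨r ∘ τ, fun _ _ hab => hs hab⟩, τ⁻¹), by simp, ?_⟩
    ext i
    simp
  · intro p _
    rfl

/-- The Cauchy–Binet formula for the first `l` columns of a determinant. -/
theorem det_addCases_sum {R : Type*} [CommRing R] {l N B : ℕ} (a : Fin B → Fin l → R)
    (b : Fin (l + N) → Fin B → R) (r : Fin (l + N) → Fin N → R) :
    (Matrix.of fun i j => (Fin.addCases (fun j => ∑ k, a k j * b i k) (fun j => r i j) j : R)).det =
      ∑ k : {k : Fin l → Fin B // StrictAnti k}, (Matrix.of fun i j => a (k.1 i) j).det *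
        (Matrix.of fun i j => (Fin.addCases (fun j => b i (k.1 j)) (fun j => r i j) j : R)).det := by
  set f := detAppend (fun j i => r i j) with hf
  have h1 : (Matrix.of fun i j => (Fin.addCases (fun j => ∑ k, a k j * b i k)
      (fun j => r i j) j : R)).det = f fun j => ∑ k, a k j • fun i => b i k := by
    rw [hf, detAppend_apply]
    congr 1
    ext i j
    induction j using Fin.addCases <;> simp
  rw [h1]
  have h2 : (f fun j => ∑ k, a k j • fun i => b i k)
      = ∑ s : Fin l → Fin B, (∏ j, a (s j) j) * f fun j i => b i (s j) := by
    have := f.toMultilinearMap.map_sum (fun j k => a k j • fun i => b i k)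
    refine this.trans (Finset.sum_congr rfl fun s _ => ?_)
    exact f.toMultilinearMap.map_smul_univ (fun j => a (s j) j) fun j i => b i (s j)
  rw [h2, sum_injective_eq]
  · refine Finset.sum_congr rfl fun k _ => ?_
    have h3 : ∀ σ : Equiv.Perm (Fin l), (f fun j i => b i ((k.1 ∘ σ) j))
        = Equiv.Perm.sign σ • f fun j i => b i (k.1 j) := fun σ =>
      f.map_perm (fun j i => b i (k.1 j)) σ
    simp only [h3]
    rw [← detAppend_apply (fun j i => r i j) (fun j i => b i (k.1 j)), ← hf,
      Matrix.det_apply, Finset.sum_mul]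
    refine Finset.sum_congr rfl fun σ _ => ?_
    simp only [Matrix.of_apply, Function.comp_apply]
    rw [mul_smul_comm, smul_mul_assoc]
  · intro s hs
    rw [Function.Injective] at hs
    push Not at hs
    obtain ⟨i, j, hij, hne⟩ := hs
    rw [f.map_eq_zero_of_eq _ (i := i) (j := j) (by ext; simp [hij]) hne, mul_zero]

end CauchyBinet

/-! ### The generating series of the h_n(x^±) -/

section HSeries

variable {K : Type*} [Field K]

/-- The generating function `∏_i 1 / ((1 - x_i z) (1 - x_i⁻¹ z))`. -/
def hSeries {N : ℕ} (x : Fin N → K) : K⟦X⟧ :=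
  ∏ i, ((1 - PowerSeries.C (x i) * PowerSeries.X)⁻¹ *
    (1 - PowerSeries.C (x i)⁻¹ * PowerSeries.X)⁻¹)

theorem hPM_eq {N : ℕ} (x : Fin N → K) : hPM x = powerSeriesSeq (hSeries x) := rfl

theorem prod_quadSeries_mul_hSeries {N : ℕ} (x : Fin N → K) (hx : ∀ i, x i ≠ 0) :
    (∏ i, quadSeries (x i + (x i)⁻¹)) * hSeries x = 1 := by
  rw [hSeries, ← Finset.prod_mul_distrib]
  refine Finset.prod_eq_one fun i _ => ?_
  have hq : quadSeries (x i + (x i)⁻¹) = (1 - PowerSeries.C (x i) * PowerSeries.X) *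
      (1 - PowerSeries.C (x i)⁻¹ * PowerSeries.X) := by
    have : (PowerSeries.C (x i) * PowerSeries.C (x i)⁻¹ : K⟦X⟧) = 1 := by
      rw [← map_mul, mul_inv_cancel₀ (hx i), map_one]
    rw [quadSeries, map_add]
    linear_combination (-PowerSeries.X ^ 2) * this
  rw [hq, mul_mul_mul_comm, PowerSeries.mul_inv_cancel _ (by simp),
    PowerSeries.mul_inv_cancel _ (by simp), one_mul]

theorem map_quadSeries {R S : Type*} [CommRing R] [CommRing S] (f : R →+* S) (T : R) :
    PowerSeries.map f (quadSeries T) = quadSeries (f T) := by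
  simp [quadSeries]

theorem hSeries_append {l N : ℕ} (y : Fin l → K) (x : Fin N → K) :
    hSeries (Fin.append y x) = hSeries y * hSeries x := by
  simp [hSeries, Fin.prod_univ_add]

end HSeries

/-! ### Determinants attached to kets, and the weight of the bra -/

section Characters

universe u

variable {K : Type u} [Field K]

/-- Applying a functional that is multiplicative on products of one-variable Laurent
polynomials to a determinant whose columns involve separate variables. -/
theorem map_det_addCases {R : Type*} [CommRing R] [Algebra K R] {l N : ℕ} (w : Fin l → Rˣ)
    (c : R →ₗ[K] K) (mu : Fin l → ℤ)
    (hc : ∀ F : Fin l → K[T;T⁻¹], c (∏ j, LaurentPolynomial.eval₂ (algebraMap K R) (w j) (F j))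
        = ∏ j, (F j).coeff (mu j))
    (P : Fin (l + N) → Fin l → K[T;T⁻¹]) (b : Fin (l + N) → Fin N → K) :
    c (Matrix.of fun i j => (Fin.addCases
      (fun j => LaurentPolynomial.eval₂ (algebraMap K R) (w j) (P i j))
      (fun j => algebraMap K R (b i j)) j : R)).det =
    (Matrix.of fun i j => (Fin.addCases (fun j => (P i j).coeff (mu j)) (fun j => b i j) j : K)).det := by
  rw [Matrix.det_apply, Matrix.det_apply, map_sum]
  refine Finset.sum_congr rfl fun σ _ => ?_
  rw [LinearMap.map_smul_of_tower]
  congr 1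
  simp only [Matrix.of_apply, Fin.prod_univ_add, Fin.addCases_left, Fin.addCases_right]
  rw [← map_prod, mul_comm, ← Algebra.smul_def, map_smul, hc, smul_eq_mul, mul_comm]

variable [CharZero K]

/-- The determinant `det (h_{λ_i-i+j} + h_{λ_i-i-j+1})` of odd orthogonal type, up to column
operations, for the sequence `h` of coefficients of a power series. -/
def soDet {R : Type*} [CommRing R] (F : R⟦X⟧) {m : ℕ} (lam : Fin m → ℕ) : R :=
  (Matrix.of fun i j : Fin m => coeffFunctional (onePlus (powerSeriesSeq F))
    ((lam i : ℤ) - (i : ℕ)) (Polynomial.X ^ (j : ℕ))).det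

theorem map_soDet {R S : Type*} [CommRing R] [CommRing S] (f : R →+* S) (F : R⟦X⟧) {m : ℕ}
    (lam : Fin m → ℕ) : f (soDet F lam) = soDet (PowerSeries.map f F) lam := by
  rw [soDet, RingHom.map_det, soDet]
  congr 1
  ext i j
  simp only [RingHom.mapMatrix_apply, Matrix.map_apply, Matrix.of_apply, map_coeffFunctional,
    Polynomial.map_pow, Polynomial.map_X]
  congr 2
  ext n
  simp [onePlus, map_powerSeriesSeq]

theorem ket_eq_soDet {m : ℕ} (lam : GenPartition m) :
    (ket lam : Fock K) = soDet (createPart 1) lam.1 :=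
  prod_U_apply_one m fun i => lam.1 i

theorem map_createPart_eq_map_hSeries {R : Type*} [CommRing R] [Algebra K R] {N : ℕ}
    (x : Fin N → K) (hx : ∀ i, x i ≠ 0) (f : Fock K →ₐ[K] R)
    (hf : ∀ n, f (MvPolynomial.X n) = algebraMap K R (powerSumPM x n)) :
    PowerSeries.map (f : Fock K →+* R) (createPart 1)
      = PowerSeries.map (algebraMap K R) (hSeries x) := by
  set g : Fock K →ₐ[K] R := MvPolynomial.aeval fun _ => 0 with hg
  have h1 := (prod_quadSeries_mul_map_createPart Finset.univ f g
    (fun i => algebraMap K R (x i)) (fun i => algebraMap K R (x i)⁻¹)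
    (fun i => by rw [← map_mul, mul_inv_cancel₀ (hx i), map_one])
    (fun n => by
      rw [hf, hg, MvPolynomial.aeval_X, zero_add, powerSumPM, map_sum]
      simp only [map_add, map_pow])).trans
    (map_createPart_of_X_eq_zero g (by simp [hg]))
  have h2 := congrArg (PowerSeries.map (algebraMap K R)) (prod_quadSeries_mul_hSeries x hx)
  rw [map_mul, map_prod, map_one] at h2
  simp only [map_quadSeries, map_add] at h2
  exact left_inv_eq_right_inv ((mul_comm _ _).trans h1) h2

theorem vacuumDual_GammaPlus_ket {N m : ℕ} (x : Fin N → K) (hx : ∀ i, x i ≠ 0)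
    (lam : GenPartition m) :
    vacuumDual (GammaPlus x (ket lam)) = soDet (hSeries x) lam.1 := by
  rw [vacuumDual_apply, GammaPlus_apply, constantCoeff_translate, ket_eq_soDet]
  have h := map_soDet ((MvPolynomial.aeval (powerSumPM x) : Fock K →ₐ[K] K) : Fock K →+* K)
    (createPart 1) lam.1
  rw [map_createPart_eq_map_hSeries x hx _ fun n => by simp] at h
  simpa using h

/-- With T_i = w_i + w_i⁻¹, each pair i < j contributes (1 - w_i w_j)(1 - w_i / w_j) = w_i (T_i -
T_j), and there are l - 1 - i indices j > i. -/
theorem braWeight_eq {R : Type*} [CommRing R] {l : ℕ} (w : Fin l → Rˣ) :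
    braWeight w = (∏ i, (1 - (w i : R)) * (w i : R) ^ (l - 1 - (i : ℕ))) *
      revVandermonde fun i => (w i : R) + ((w i)⁻¹ : Rˣ) := by
  rw [braWeight, revVandermonde, ← Finset.prod_mul_distrib]
  refine Finset.prod_congr rfl fun i _ => ?_
  have hcard : (w i : R) ^ (l - 1 - (i : ℕ)) = ∏ j ∈ Finset.Ioi i, (w i : R) := by
    rw [Finset.prod_const, Fin.card_Ioi]
  rw [mul_assoc, hcard, ← Finset.prod_mul_distrib]
  congr 1
  refine Finset.prod_congr rfl fun j _ => ?_
  have h1 : (w i : R) * ((w i)⁻¹ : Rˣ) = 1 := Units.mul_inv _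
  have h2 : (w j : R) * ((w j)⁻¹ : Rˣ) = 1 := Units.mul_inv _
  linear_combination ((w i : R) ^ 2) * h2 - h1

theorem one_sub_mul_chi {R : Type*} [CommRing R] (w : Rˣ) (k : ℕ) :
    (1 - (w : R)) * chi ((w : R) + (w⁻¹ : Rˣ)) k
      = ((w ^ (-(k : ℤ)) : Rˣ) : R) - ((w ^ ((k : ℤ) + 1) : Rˣ) : R) := by
  have hw : (w : R) * (w⁻¹ : Rˣ) = 1 := Units.mul_inv _
  induction k using Nat.twoStepInduction with
  | zero => simp [chi]
  | one =>
    have : ((w ^ ((1 : ℕ) : ℤ) : Rˣ) : R) = w := by simp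
    rw [chi, zpow_add, zpow_neg, Nat.cast_one, zpow_one, Units.val_mul]
    linear_combination -hw
  | more k h0 h1 =>
    have e1 : ((w ^ (-((k + 2 : ℕ) : ℤ)) : Rˣ) : R)
        = ((w ^ (-(k : ℤ)) : Rˣ) : R) * (w⁻¹ : Rˣ) ^ 2 := by
      rw [← Units.val_pow_eq_pow_val, ← Units.val_mul, inv_pow, ← zpow_natCast, ← zpow_neg,
        ← zpow_add]
      congr 2; push_cast; ring
    have e2 : ((w ^ (-((k + 1 : ℕ) : ℤ)) : Rˣ) : R)
        = ((w ^ (-(k : ℤ)) : Rˣ) : R) * (w⁻¹ : Rˣ) := by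
      rw [← Units.val_mul, ← zpow_neg_one, ← zpow_add]
      congr 2; push_cast; ring
    have e3 : ((w ^ (((k + 2 : ℕ) : ℤ) + 1) : Rˣ) : R)
        = ((w ^ ((k : ℤ) + 1) : Rˣ) : R) * w ^ 2 := by
      rw [← Units.val_pow_eq_pow_val, ← Units.val_mul, ← zpow_natCast, ← zpow_add]
      congr 2
    have e4 : ((w ^ (((k + 1 : ℕ) : ℤ) + 1) : Rˣ) : R)
        = ((w ^ ((k : ℤ) + 1) : Rˣ) : R) * w := by
      rw [← Units.val_mul, ← zpow_add_one]
      congr 2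
    rw [e2, e4] at h1
    rw [e1, e3, chi, mul_sub, mul_left_comm, h1, h0]
    linear_combination (((w ^ (-(k : ℤ)) : Rˣ) : R) - ((w ^ ((k : ℤ) + 1) : Rˣ) : R)) * hw

end Characters

/-! ### The Jacobi–Trudi identity for skew characters -/

section SkewCharacters

universe u

variable {K : Type u} [Field K]

/-- The exponents r + k + 1 are positive, so only T^{r-k} with k = m + r can reach the exponent -m.
-/
theorem coeff_sum_C_mul_T_sub (g : ℤ → K) (B r : ℕ) (m : ℕ) (hB : m + r < B) :
    (∑ k ∈ Finset.range B, LaurentPolynomial.C (g k) *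
      (LaurentPolynomial.T (r - (k : ℤ)) - LaurentPolynomial.T (r + (k + 1 : ℤ)))
        : K[T;T⁻¹]).coeff (-(m : ℤ)) = g (m + r : ℕ) := by
  rw [AddMonoidAlgebra.coeff_sum, Finset.sum_apply',
    Finset.sum_eq_single (m + r)]
  · rw [coeff_C_mul, AddMonoidAlgebra.coeff_sub, Finsupp.sub_apply, LaurentPolynomial.T_apply,
      LaurentPolynomial.T_apply, if_pos (by push_cast; ring), if_neg (by push_cast; omega), sub_zero,
      mul_one]
  · intro k _ hk
    rw [coeff_C_mul, AddMonoidAlgebra.coeff_sub, Finsupp.sub_apply, LaurentPolynomial.T_apply,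
      LaurentPolynomial.T_apply, if_neg (by omega), if_neg (by omega), sub_zero, mul_zero]
  · intro h
    exact absurd (Finset.mem_range.2 hB) h

theorem jtMatrix_eq {l N : ℕ} (lam : GenPartition (l + N)) (mu : GenPartition l) (x : Fin N → K) :
    jtMatrix lam mu x = Matrix.of fun i j : Fin (l + N) => (Fin.addCases
      (fun j => powerSeriesSeq (hSeries x)
        ((lam.1 i : ℤ) - (i : ℕ) + l - 1 - (mu.1 j + (l - 1 - (j : ℕ)) : ℕ)))
      (fun j => powerSeriesSeq (hSeries x) ((lam.1 i : ℤ) - (i : ℕ) + l - (j : ℕ) - 1)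
        + powerSeriesSeq (hSeries x) ((lam.1 i : ℤ) - (i : ℕ) + l + (j : ℕ))) j : K) := by
  ext i j
  rw [jtMatrix, Matrix.of_apply, Matrix.of_apply, ← hPM_eq]
  induction j using Fin.addCases with
  | left j =>
    have hj := j.2
    rw [dif_pos (by simp), Fin.addCases_left]
    congr 1
    simp only [Fin.val_castAdd, Fin.eta]
    omega
  | right j =>
    rw [dif_neg (by simp), Fin.addCases_right, add_comm]
    congr 2
    · simp only [Fin.val_natAdd]; push_cast; ring
    · simp only [Fin.val_natAdd]; push_cast; ring

variable [CharZero K]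

/-- Evaluation at the combined alphabet (w, x) puts the factors 1 - (w_i + w_i⁻¹) z + z² in the
denominator of `hSeries x`. After they are cleared, column j < l involves w_j alone and the other
columns no w at all, so c may be applied column by column. -/
theorem skewSO_eq_det {l N : ℕ} (lam : GenPartition (l + N)) (mu : GenPartition l) (x : Fin N → K)
    (hx : ∀ i, x i ≠ 0) : skewSO lam mu x = (jtMatrix lam mu x).det := by
  obtain ⟨R, _, _, w, c, h1, h2⟩ := exists_bra_eq (K := K) l fun j => mu.1 j
  set f : Fock K →ₐ[K] R := (evalPM w).comp
    ((translate (powerSumPM x) : Fock K →ₐ[K] Fock K)) with hf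
  set g : Fock K →ₐ[K] R := MvPolynomial.aeval fun n => algebraMap K R (powerSumPM x n) with hg
  have hskew : skewSO lam mu x = c (braWeight w *
      soDet (PowerSeries.map (f : Fock K →+* R) (createPart 1)) lam.1) := by
    rw [← map_soDet, ← ket_eq_soDet]
    have := h1 (GammaPlus x (ket lam))
    rw [GammaPlus_apply] at this
    rw [skewSO, GammaPlus_apply]
    exact this
  have hFG := (prod_quadSeries_mul_map_createPart Finset.univ f g (fun i => (w i : R))
    (fun i => ((w i)⁻¹ : Rˣ)) (by simp) (fun n => by
      rw [hf, AlgHom.comp_apply, translate, MvPolynomial.aeval_X, map_add, evalPM_X, hg,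
        MvPolynomial.aeval_X, add_comm]
      congr 1
      simp [evalPM])).trans (map_createPart_eq_map_hSeries x hx g fun n => by
        rw [hg, MvPolynomial.aeval_X])
  -- B exceeds every λ_i - i + l - 1, so the truncated sums are exact, and every μ_j + l - 1 - j, so
  -- the selected index lies in range.
  set B := ∑ i, lam.1 i + ∑ j, mu.1 j + l + 1 with hB
  have hlam : ∀ i, lam.1 i ≤ ∑ i, lam.1 i := fun i =>
    Finset.single_le_sum (f := lam.1) (fun _ _ => Nat.zero_le _) (Finset.mem_univ i)
  have hmu : ∀ i, mu.1 i ≤ ∑ i, mu.1 i := fun i =>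
    Finset.single_le_sum (f := mu.1) (fun _ _ => Nat.zero_le _) (Finset.mem_univ i)
  have hdet := det_mul_revVandermonde (fun i => (w i : R) + ((w i)⁻¹ : Rˣ)) _ _ hFG
    (fun i => (lam.1 i : ℤ) - (i : ℕ)) B fun i => by
      have := hlam i
      omega
  -- The weight supplies the factor `revVandermonde` required by `hdet`; its remaining factors (1 -
  -- w_j) w_j^{l-1-j} scale the first l columns.
  rw [hskew, braWeight_eq, mul_assoc, mul_comm (revVandermonde _), soDet, hdet]
  have hcol := Matrix.det_mul_row (Fin.addCases
    (fun i : Fin l => (1 - (w i : R)) * (w i : R) ^ (l - 1 - (i : ℕ))) (fun _ : Fin N => (1 : R)))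
    (Matrix.of fun i j : Fin (l + N) => (Fin.addCases
      (fun j => ∑ k ∈ Finset.range B, chi ((w j : R) + ((w j)⁻¹ : Rˣ)) k *
        powerSeriesSeq (PowerSeries.map (algebraMap K R) (hSeries x))
          ((lam.1 i : ℤ) - (i : ℕ) + l - 1 - k))
      (fun j => powerSeriesSeq (PowerSeries.map (algebraMap K R) (hSeries x))
          ((lam.1 i : ℤ) - (i : ℕ) + l - (j : ℕ) - 1)
        + powerSeriesSeq (PowerSeries.map (algebraMap K R) (hSeries x))
          ((lam.1 i : ℤ) - (i : ℕ) + l + (j : ℕ))) j : R))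
  rw [Fin.prod_univ_add] at hcol
  simp only [Fin.addCases_left, Fin.addCases_right, Finset.prod_const_one, mul_one] at hcol
  rw [← hcol, jtMatrix_eq]
  have hP := map_det_addCases w c (fun j => -(mu.1 j : ℤ)) h2
    (fun i j => ∑ k ∈ Finset.range B, LaurentPolynomial.C (powerSeriesSeq (hSeries x)
      ((lam.1 i : ℤ) - (i : ℕ) + l - 1 - (k : ℤ))) *
      (LaurentPolynomial.T ((l - 1 - (j : ℕ) : ℕ) - (k : ℤ)) -
        LaurentPolynomial.T ((l - 1 - (j : ℕ) : ℕ) + (k + 1 : ℤ))))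
    (fun i (j : Fin N) => powerSeriesSeq (hSeries x) ((lam.1 i : ℤ) - (i : ℕ) + l - (j : ℕ) - 1)
        + powerSeriesSeq (hSeries x) ((lam.1 i : ℤ) - (i : ℕ) + l + (j : ℕ)))
  convert hP using 2
  · congr 1
    ext i j
    rw [Matrix.of_apply, Matrix.of_apply, Matrix.of_apply]
    induction j using Fin.addCases with
    | left j =>
      simp only [Fin.addCases_left]
      rw [Finset.mul_sum, map_sum]
      refine Finset.sum_congr rfl fun k _ => ?_
      rw [map_mul, map_sub, LaurentPolynomial.eval₂_C, LaurentPolynomial.eval₂_T,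
        LaurentPolynomial.eval₂_T, map_powerSeriesSeq, zpow_add, zpow_natCast]
      rw [show ((l - 1 - (j : ℕ) : ℕ) : ℤ) - k = ((l - 1 - (j : ℕ) : ℕ) : ℤ) + (-k : ℤ) from
        sub_eq_add_neg _ _, zpow_add, Units.val_mul, Units.val_mul, zpow_natCast,
        Units.val_pow_eq_pow_val]
      linear_combination (powerSeriesSeq (PowerSeries.map (algebraMap K R) (hSeries x))
        ((lam.1 i : ℤ) - (i : ℕ) + l - 1 - k) * (w j : R) ^ (l - 1 - (j : ℕ))) *
        one_sub_mul_chi (w j) k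
    | right j =>
      simp only [Fin.addCases_right]
      rw [one_mul, map_add, map_powerSeriesSeq, map_powerSeriesSeq]
  · ext i j
    rw [Matrix.of_apply, Matrix.of_apply]
    induction j using Fin.addCases with
    | left j =>
      simp only [Fin.addCases_left]
      have h := coeff_sum_C_mul_T_sub (fun k => powerSeriesSeq (hSeries x)
        ((lam.1 i : ℤ) - (i : ℕ) + l - 1 - k)) B (l - 1 - (j : ℕ)) (mu.1 j) (by
          have := hmu j
          have := j.2
          omega)
      exact h.symm
    | right j => simp only [Fin.addCases_right]

/-- If some part of μ exceeds ∑ λ_i, so does the largest one, and then the first column of the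
Jacobi–Trudi matrix has only negative indices. -/
theorem le_of_skewSO_ne_zero {l N : ℕ} (lam : GenPartition (l + N)) (mu : GenPartition l)
    (x : Fin N → K) (hx : ∀ i, x i ≠ 0) (h : skewSO lam mu x ≠ 0) (j : Fin l) :
    mu.1 j ≤ ∑ i, lam.1 i := by
  by_contra! hj
  have hl : 0 < l := j.pos
  refine h ?_
  rw [skewSO_eq_det lam mu x hx, jtMatrix_eq]
  refine Matrix.det_eq_zero_of_column_eq_zero (Fin.castAdd N ⟨0, hl⟩) fun i => ?_
  rw [Matrix.of_apply, Fin.addCases_left]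
  refine powerSeriesSeq_of_neg _ ?_
  have h1 : mu.1 j ≤ mu.1 ⟨0, hl⟩ := mu.2 (Fin.mk_le_of_le_val (Nat.zero_le _))
  have h2 : lam.1 i ≤ ∑ i, lam.1 i :=
    Finset.single_le_sum (f := lam.1) (fun _ _ => Nat.zero_le _) (Finset.mem_univ i)
  simp only
  omega

theorem finite_skewSO_ne_zero {l N : ℕ} (lam : GenPartition (l + N)) (x : Fin N → K)
    (hx : ∀ i, x i ≠ 0) : {mu : GenPartition l | skewSO lam mu x ≠ 0}.Finite := by
  refine ((Set.finite_Iic fun _ : Fin l => ∑ i, lam.1 i).preimage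
    Subtype.val_injective.injOn).subset fun mu hmu => ?_
  exact fun j => le_of_skewSO_ne_zero lam mu x hx hmu j

end SkewCharacters

/-! ### Strictly decreasing tuples and generalized partitions -/

section StrictAntiTuples

theorem StrictAnti.add_le {l B : ℕ} {k : Fin l → Fin B} (hk : StrictAnti k) :
    ∀ (d : ℕ) (i j : Fin l), (j : ℕ) = i + d → (k j : ℕ) + d ≤ k i := by
  intro d
  induction d with
  | zero => intro i j h; obtain rfl : j = i := Fin.ext (by simpa using h); simp
  | succ d ih =>
    intro i j h
    have hi : (i : ℕ) + 1 < l := by omega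
    have h1 := ih ⟨i + 1, hi⟩ j (by simp only; omega)
    have h2 : (k ⟨i + 1, hi⟩ : ℕ) < k i := hk (Fin.mk_lt_of_lt_val (by simp))
    omega

theorem StrictAnti.le_val {l B : ℕ} {k : Fin l → Fin B} (hk : StrictAnti k) (j : Fin l) :
    l - 1 - (j : ℕ) ≤ k j := by
  have hj := j.2
  have := StrictAnti.add_le hk (l - 1 - j) j ⟨l - 1, by omega⟩ (by simp only; omega)
  omega

/-- Subtracting the staircase `(l-1, …, 1, 0)` from a strictly decreasing tuple. -/
def subStaircase {l B : ℕ} (k : {k : Fin l → Fin B // StrictAnti k}) : GenPartition l :=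
  ⟨fun j => (k.1 j : ℕ) - (l - 1 - (j : ℕ)), fun i j hij => by
    have h1 := StrictAnti.add_le k.2 (j - i) i j (by have : (i : ℕ) ≤ j := hij; omega)
    have h2 := StrictAnti.le_val k.2 j
    have := j.2
    have : (i : ℕ) ≤ j := hij
    simp only
    omega⟩

theorem subStaircase_add {l B : ℕ} (k : {k : Fin l → Fin B // StrictAnti k}) (j : Fin l) :
    (subStaircase k).1 j + (l - 1 - (j : ℕ)) = k.1 j :=
  Nat.sub_add_cancel (StrictAnti.le_val k.2 j)

theorem subStaircase_injective {l B : ℕ} :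
    Function.Injective (subStaircase : {k : Fin l → Fin B // StrictAnti k} → GenPartition l) := by
  intro k k' h
  ext j
  rw [← subStaircase_add, ← subStaircase_add, h]

theorem mem_range_subStaircase {l B : ℕ} (mu : GenPartition l) (h : ∀ j, mu.1 j + l < B) :
    mu ∈ Set.range (subStaircase : {k : Fin l → Fin B // StrictAnti k} → GenPartition l) := by
  refine ⟨⟨fun j => ⟨mu.1 j + (l - 1 - (j : ℕ)), by have := h j; omega⟩, fun i j hij => ?_⟩, ?_⟩
  · have h1 : mu.1 j ≤ mu.1 i := mu.2 hij.le
    have h2 : (i : ℕ) < j := hij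
    have h3 := j.2
    refine Fin.mk_lt_mk.2 ?_
    omega
  · ext j
    simp [subStaircase]

end StrictAntiTuples

/-! ### Branching for determinants -/

section Branching

/-- This is `det_mul_revVandermonde` with N = 0 and G = 1: only the term of the convolution where
the index of G is zero survives. -/
theorem soDet_mul_revVandermonde {R : Type*} [CommRing R] {l : ℕ} (T : Fin l → R) (F : R⟦X⟧)
    (hF : (∏ i, quadSeries (T i)) * F = 1) (mu : Fin l → ℕ) :
    soDet F mu * revVandermonde T =
      (Matrix.of fun i j => chi (T j) (mu i + (l - 1 - (i : ℕ)))).det := by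
  set B := ∑ j, mu j + l + 1 with hB
  have hmu : ∀ i, mu i ≤ ∑ i, mu i := fun i =>
    Finset.single_le_sum (f := mu) (fun _ _ => Nat.zero_le _) (Finset.mem_univ i)
  have h := det_mul_revVandermonde (N := 0) T F 1 hF (fun i => (mu i : ℤ) - (i : ℕ)) B fun i => by
    have := hmu i
    omega
  refine h.trans ?_
  congr 1
  ext i j
  rw [Matrix.of_apply, Matrix.of_apply]
  refine (Fin.addCases_left (m := l) (n := 0) j).trans ?_
  have hi := i.2
  have h1 := hmu i
  have hi' : (i : ℕ) < l := hi
  rw [Finset.sum_eq_single (mu i + (l - 1 - (i : ℕ)))]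
  · rw [show (mu i : ℤ) - (i : ℕ) + l - 1 - ((mu i + (l - 1 - (i : ℕ)) : ℕ) : ℤ) = ((0 : ℕ) : ℤ) by
      omega, powerSeriesSeq_natCast]
    simp
  · intro k _ hk
    rcases lt_or_ge ((mu i : ℤ) - (i : ℕ) + l - 1 - k) 0 with h | h
    · rw [powerSeriesSeq_of_neg _ h, mul_zero]
    · obtain ⟨n, hn⟩ := Int.eq_ofNat_of_zero_le h
      rw [hn, powerSeriesSeq_natCast, PowerSeries.coeff_one, if_neg (by omega), mul_zero]
  · intro h
    exact absurd (Finset.mem_range.2 (by omega)) h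

/-- The matrix of Jacobi–Trudi type with `l` columns involving `mu`. -/
def skewDet {R : Type*} [CommRing R] (G : R⟦X⟧) {l N : ℕ} (lam : Fin (l + N) → ℕ)
    (mu : Fin l → ℕ) : R :=
  (Matrix.of fun i j : Fin (l + N) => (Fin.addCases
      (fun j => powerSeriesSeq G
        ((lam i : ℤ) - (i : ℕ) + l - 1 - (mu j + (l - 1 - (j : ℕ)) : ℕ)))
      (fun j => powerSeriesSeq G ((lam i : ℤ) - (i : ℕ) + l - (j : ℕ) - 1)
        + powerSeriesSeq G ((lam i : ℤ) - (i : ℕ) + l + (j : ℕ))) j : R)).det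

theorem map_skewDet {R S : Type*} [CommRing R] [CommRing S] (f : R →+* S) (G : R⟦X⟧) {l N : ℕ}
    (lam : Fin (l + N) → ℕ) (mu : Fin l → ℕ) :
    f (skewDet G lam mu) = skewDet (PowerSeries.map f G) lam mu := by
  rw [skewDet, RingHom.map_det, skewDet]
  congr 1
  ext i j
  simp only [RingHom.mapMatrix_apply, Matrix.map_apply, Matrix.of_apply]
  induction j using Fin.addCases with
  | left j => simp only [Fin.addCases_left, map_powerSeriesSeq]
  | right j => simp only [Fin.addCases_right, map_powerSeriesSeq, map_add]

/-- Cauchy–Binet splits the cleared determinant into det(χ_{k_i}(T_j)) times a skew determinant. By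
`soDet_mul_revVandermonde` the first factor carries the same `revVandermonde T`, which cancels. -/
theorem soDet_mul_eq_sum_of_revVandermonde_ne_zero {R : Type*} [CommRing R] [IsDomain R] {l N : ℕ}
    (T : Fin l → R) (hT : revVandermonde T ≠ 0) (F G : R⟦X⟧)
    (hF : (∏ i, quadSeries (T i)) * F = 1) (lam : Fin (l + N) → ℕ) (B : ℕ)
    (hB : ∀ i, lam i + l < B) :
    soDet (F * G) lam = ∑ k : {k : Fin l → Fin B // StrictAnti k},
      soDet F (subStaircase k).1 * skewDet G lam (subStaircase k).1 := by
  refine mul_right_cancel₀ hT ?_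
  have hFG : (∏ i, quadSeries (T i)) * (F * G) = G := by rw [← mul_assoc, hF, one_mul]
  have h := det_mul_revVandermonde T _ _ hFG (fun i => (lam i : ℤ) - (i : ℕ)) B fun i => by
    have := hB i
    omega
  have hCB := det_addCases_sum (fun (k : Fin B) (j : Fin l) => chi (T j) k)
    (fun (i : Fin (l + N)) k => powerSeriesSeq G ((lam i : ℤ) - (i : ℕ) + l - 1 - (k : ℕ)))
    (fun i (j : Fin N) => powerSeriesSeq G ((lam i : ℤ) - (i : ℕ) + l - (j : ℕ) - 1)
        + powerSeriesSeq G ((lam i : ℤ) - (i : ℕ) + l + (j : ℕ)))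
  rw [soDet, h]
  simp only [← Fin.sum_univ_eq_sum_range (fun k => chi _ k *
    powerSeriesSeq G ((lam _ : ℤ) - ((_ : Fin _) : ℕ) + l - 1 - k))]
  rw [hCB, Finset.sum_mul]
  refine Finset.sum_congr rfl fun k _ => ?_
  rw [mul_right_comm, soDet_mul_revVandermonde T F hF, skewDet]
  simp only [subStaircase_add]

/-- For indeterminate T_i the product of differences is nonzero in a domain, and both sides are
compatible with specialisation. Coinciding T_i are thereby included. -/
theorem soDet_mul_eq_sum {R : Type*} [CommRing R] [IsDomain R] {l N : ℕ}
    (T : Fin l → R) (F G : R⟦X⟧)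
    (hF : (∏ i, quadSeries (T i)) * F = 1) (lam : Fin (l + N) → ℕ) (B : ℕ)
    (hB : ∀ i, lam i + l < B) :
    soDet (F * G) lam = ∑ k : {k : Fin l → Fin B // StrictAnti k},
      soDet F (subStaircase k).1 * skewDet G lam (subStaircase k).1 := by
  set Y : Fin l → MvPolynomial (Fin l) R := MvPolynomial.X
  have hY : revVandermonde Y ≠ 0 := by
    refine Finset.prod_ne_zero_iff.2 fun i _ => Finset.prod_ne_zero_iff.2 fun j hj => ?_
    rw [sub_ne_zero]
    exact fun h => (Finset.mem_Ioi.1 hj).ne (MvPolynomial.X_injective h)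
  have hu : IsUnit (∏ i, quadSeries (Y i)) := by
    rw [IsUnit.prod_univ_iff]
    exact fun i => isUnit_quadSeries _
  obtain ⟨F', hF'⟩ := hu.exists_right_inv
  set f : MvPolynomial (Fin l) R →+* R := (MvPolynomial.aeval T : _ →ₐ[R] R).toRingHom with hf
  have hfY : ∀ i, f (Y i) = T i := fun i => by simp [hf, Y]
  have h := congrArg f (soDet_mul_eq_sum_of_revVandermonde_ne_zero Y hY F'
    (PowerSeries.map MvPolynomial.C G) hF' lam B hB)
  have hG : PowerSeries.map f (PowerSeries.map MvPolynomial.C G) = G := by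
    ext n
    simp [hf]
  -- Both are inverses of the same product of quadratic series.
  have hFF : PowerSeries.map f F' = F := by
    have h2 := congrArg (PowerSeries.map f) hF'
    rw [map_mul, map_prod, map_one] at h2
    simp only [map_quadSeries, hfY] at h2
    exact (left_inv_eq_right_inv ((mul_comm _ _).trans hF) h2).symm
  simpa only [map_soDet, map_sum, map_mul, map_skewDet, hG, hFF] using h

/-- For λ = 0 the matrix is upper triangular, and its diagonal entry, the coefficient of z^{-i} in
t^i (1 + z) F, is the constant term of F. This evaluates the Weyl denominator. -/
theorem soDet_zero {R : Type*} [CommRing R] (F : R⟦X⟧) (hF : PowerSeries.constantCoeff F = 1)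
    (m : ℕ) : soDet F (0 : Fin m → ℕ) = 1 := by
  have hc : ∀ n < 0, onePlus (powerSeriesSeq F) n = 0 :=
    onePlus_of_neg fun n hn => powerSeriesSeq_of_neg F hn
  nontriviality R
  have hd : ∀ d : ℕ, coeffFunctional (onePlus (powerSeriesSeq F)) (-(d : ℤ)) (Polynomial.X ^ d)
      = 1 := by
    intro d
    induction d with
    | zero =>
      rw [pow_zero, coeffFunctional_one, onePlus, powerSeriesSeq_of_neg F (n := _ - 1) (by simp)]
      simpa [powerSeriesSeq] using hF
    | succ d ih =>
      rw [pow_succ', coeffFunctional_mul, coeffFunctional_X,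
        coeffFunctional_eq_zero _ hc _ _ (by rw [Polynomial.natDegree_X_pow]; push_cast; omega)]
      rw [show -((d + 1 : ℕ) : ℤ) + 1 = -(d : ℤ) by push_cast; ring, ih, zero_add]
  rw [soDet, Matrix.det_of_isUpperTriangular]
  · refine Finset.prod_eq_one fun i _ => ?_
    simpa using hd i
  · intro i j hij
    have : (j : ℕ) < i := hij
    rw [Matrix.of_apply]
    refine coeffFunctional_eq_zero _ hc _ _ ?_
    rw [Polynomial.natDegree_X_pow]
    simp only [Pi.zero_apply]
    omega

end Branching

/-! ### The Weyl character formula -/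

section Weyl

variable {K : Type*} [Field K]

theorem constantCoeff_hSeries {N : ℕ} (x : Fin N → K) :
    PowerSeries.constantCoeff (hSeries x) = 1 := by
  simp [hSeries, map_prod]

theorem sub_inv_mul_chi (t : K) (ht : t ≠ 0) (k : ℕ) :
    (t - t⁻¹) * chi (t ^ 2 + (t ^ 2)⁻¹) k = t ^ (2 * (k : ℤ) + 1) - t ^ (-(2 * (k : ℤ) + 1)) := by
  have h := one_sub_mul_chi (Units.mk0 (t ^ 2) (pow_ne_zero 2 ht)) k
  simp only [Units.val_mk0, Units.val_inv_eq_inv_val, Units.val_zpow_eq_zpow_val] at h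
  have e1 : ((t ^ 2 : K) ^ (-(k : ℤ))) = t ^ (-(2 * (k : ℤ) + 1)) * t := by
    rw [← zpow_natCast, ← zpow_mul, ← zpow_add_one₀ ht]; congr 1; push_cast; ring
  have e2 : ((t ^ 2 : K) ^ ((k : ℤ) + 1)) = t ^ (2 * (k : ℤ) + 1) * t := by
    rw [← zpow_natCast, ← zpow_mul, ← zpow_add_one₀ ht]; congr 1
  rw [e1, e2] at h
  have h3 : t - t⁻¹ = -t⁻¹ * (1 - t ^ 2) := by field_simp; ring
  rw [h3, mul_assoc, h]
  field_simp
  ring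

/-- With x_j = t_j², multiplying χ_k(x_j + x_j⁻¹) by t_j - t_j⁻¹ gives t_j^{2k+1} - t_j^{-(2k+1)}.
The Weyl determinant is thus the transposed χ-determinant with scaled columns. -/
theorem weylDet_eq {M : ℕ} (nu : Fin M → ℕ) (t : Fin M → K) (ht : ∀ i, t i ≠ 0) :
    weylDet nu t = (∏ i, (t i - (t i)⁻¹)) * revVandermonde (fun i => t i ^ 2 + (t i ^ 2)⁻¹) *
      soDet (hSeries fun i => t i ^ 2) nu := by
  rw [mul_assoc, mul_comm (revVandermonde _), soDet_mul_revVandermonde _ _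
    (prod_quadSeries_mul_hSeries _ fun i => pow_ne_zero 2 (ht i)), ← Matrix.det_mul_row, weylDet,
    ← Matrix.det_transpose]
  congr 1
  ext i j
  simp only [Matrix.transpose_apply, Matrix.of_apply]
  rw [sub_inv_mul_chi _ (ht j)]
  have := i.2
  have e : 2 * ((nu i : ℤ) + M - (i : ℕ)) - 1 = 2 * ((nu i + (M - 1 - (i : ℕ)) : ℕ) : ℤ) + 1 := by
    omega
  rw [e]

end Weyl

/-! ### Weyl denominators and the branching sum over partitions -/

section Branching

universe u

variable {K : Type u} [Field K]

theorem weylDet_zero {M : ℕ} (t : Fin M → K) (ht : ∀ i, t i ≠ 0) :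
    weylDet 0 t = (∏ i, (t i - (t i)⁻¹)) * revVandermonde (fun i => t i ^ 2 + (t i ^ 2)⁻¹) := by
  rw [weylDet_eq 0 t ht, soDet_zero _ (constantCoeff_hSeries _), mul_one]

theorem oddOrthChar_eq_soDet {M : ℕ} (nu : GenPartition M) (t : Fin M → K) (ht : ∀ i, t i ≠ 0)
    (h : weylDet 0 t ≠ 0) : oddOrthChar nu t = soDet (hSeries fun i => t i ^ 2) nu.1 := by
  rw [oddOrthChar, weylDet_eq nu.1 t ht, ← weylDet_zero t ht, mul_div_cancel_left₀ _ h]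

theorem weylDet_zero_ne_zero_iff {M : ℕ} (t : Fin M → K) (ht : ∀ i, t i ≠ 0) :
    weylDet 0 t ≠ 0 ↔ (∀ i, t i - (t i)⁻¹ ≠ 0) ∧
      ∀ i j, i < j → t i ^ 2 + (t i ^ 2)⁻¹ - (t j ^ 2 + (t j ^ 2)⁻¹) ≠ 0 := by
  rw [weylDet_zero t ht, mul_ne_zero_iff, revVandermonde]
  simp only [Finset.prod_ne_zero_iff, Finset.mem_univ, Finset.mem_Ioi, forall_true_left]

/-- The denominator factors, and every factor for s occurs among those for the combined alphabet. -/
theorem weylDet_zero_left_ne_zero {l N : ℕ} (s : Fin l → K) (t : Fin N → K)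
    (hs : ∀ i, s i ≠ 0) (ht : ∀ i, t i ≠ 0) (h : weylDet 0 (Fin.append s t) ≠ 0) :
    weylDet 0 s ≠ 0 := by
  have hst : ∀ i, Fin.append s t i ≠ 0 := fun i => by
    induction i using Fin.addCases <;> simp [hs, ht]
  rw [weylDet_zero_ne_zero_iff _ hst] at h
  rw [weylDet_zero_ne_zero_iff _ hs]
  refine ⟨fun i => by simpa using h.1 (Fin.castAdd N i), fun i j hij => ?_⟩
  simpa using h.2 (Fin.castAdd N i) (Fin.castAdd N j) hij

variable [CharZero K]

theorem soDet_append_eq_finsum {l N : ℕ} (lam : GenPartition (l + N)) (y : Fin l → K)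
    (x : Fin N → K) (hy : ∀ i, y i ≠ 0) (hx : ∀ i, x i ≠ 0) :
    soDet (hSeries (Fin.append y x)) lam.1 =
      ∑ᶠ mu : GenPartition l, soDet (hSeries y) mu.1 * skewSO lam mu x := by
  set L := ∑ i, lam.1 i with hL
  have hlam : ∀ i, lam.1 i ≤ L := fun i =>
    Finset.single_le_sum (f := lam.1) (fun _ _ => Nat.zero_le _) (Finset.mem_univ i)
  -- Strictly decreasing tuples below L + l + 1 give, after subtraction of the staircase, every μ
  -- with parts at most L. By `le_of_skewSO_ne_zero` no other μ contributes.
  rw [hSeries_append, soDet_mul_eq_sum (fun i => y i + (y i)⁻¹) _ _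
    (prod_quadSeries_mul_hSeries y hy) lam.1 (L + l + 1) fun i => by have := hlam i; omega,
    ← finsum_mem_univ, ← finsum_mem_inter_support_eq' _ (Set.range
      (subStaircase : {k : Fin l → Fin (L + l + 1) // StrictAnti k} → GenPartition l)) Set.univ,
    finsum_mem_range subStaircase_injective, finsum_eq_sum_of_fintype]
  · refine Finset.sum_congr rfl fun k _ => ?_
    rw [skewSO_eq_det lam _ x hx, jtMatrix_eq, skewDet]
  · intro mu hmu
    refine iff_of_true (mem_range_subStaircase mu fun j => ?_) (Set.mem_univ _)
    have := le_of_skewSO_ne_zero lam mu x hx (right_ne_zero_of_mul hmu) j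
    omega

end Branching

end OddOrth

end

theorem mainTheorem1 {K : Type*} [Field K] [CharZero K] (l N : ℕ) :
    -- the Jacobi–Trudi identity for the skew characters
    (∀ (lam : OddOrth.GenPartition (l + N)) (mu : OddOrth.GenPartition l) (x : Fin N → K),
      (∀ i, x i ≠ 0) →
        OddOrth.skewSO lam mu x = (OddOrth.jtMatrix lam mu x).det) ∧
    -- the character `so_ν(x^±)` of the Weyl formula is `⟨0| Γ_+(x^±) |ν^{so}⟩`
    (∀ (M : ℕ) (nu : OddOrth.GenPartition M) (t : Fin M → K),
      (∀ i, t i ≠ 0) → OddOrth.weylDet 0 t ≠ 0 →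
        OddOrth.oddOrthChar nu t =
          OddOrth.vacuumDual (OddOrth.GammaPlus (fun i => t i ^ 2) (OddOrth.ket nu))) ∧
    -- only finitely many `μ` contribute to the branching sums
    (∀ (lam : OddOrth.GenPartition (l + N)) (x : Fin N → K), (∀ i, x i ≠ 0) →
      {mu : OddOrth.GenPartition l | OddOrth.skewSO lam mu x ≠ 0}.Finite) ∧
    -- the branching rule for matrix coefficients
    (∀ (lam : OddOrth.GenPartition (l + N)) (y : Fin l → K) (x : Fin N → K),
      (∀ i, y i ≠ 0) → (∀ i, x i ≠ 0) →
        OddOrth.vacuumDual (OddOrth.GammaPlus (Fin.append y x) (OddOrth.ket lam)) =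
          ∑ᶠ mu : OddOrth.GenPartition l,
            OddOrth.vacuumDual (OddOrth.GammaPlus y (OddOrth.ket mu)) *
              OddOrth.skewSO lam mu x) ∧
    -- the branching rule for the characters, at `y_i = s_i²` and `x_i = t_i²`
    (∀ (lam : OddOrth.GenPartition (l + N)) (s : Fin l → K) (t : Fin N → K),
      (∀ i, s i ≠ 0) → (∀ i, t i ≠ 0) → OddOrth.weylDet 0 (Fin.append s t) ≠ 0 →
        OddOrth.oddOrthChar lam (Fin.append s t) =
          ∑ᶠ mu : OddOrth.GenPartition l,
            OddOrth.oddOrthChar mu s * OddOrth.skewSO lam mu (fun i => t i ^ 2)) := by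
  have happ : ∀ (y : Fin l → K) (x : Fin N → K), (∀ i, y i ≠ 0) → (∀ i, x i ≠ 0) →
      ∀ i, Fin.append y x i ≠ 0 := fun y x hy hx i => by
    induction i using Fin.addCases <;> simp [hy, hx]
  refine ⟨fun lam mu x hx => OddOrth.skewSO_eq_det lam mu x hx, fun M nu t ht h => ?_,
    fun lam x hx => OddOrth.finite_skewSO_ne_zero lam x hx, fun lam y x hy hx => ?_,
    fun lam s t hs ht h => ?_⟩
  · rw [OddOrth.oddOrthChar_eq_soDet nu t ht h,
      OddOrth.vacuumDual_GammaPlus_ket _ fun i => pow_ne_zero 2 (ht i)]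
  · rw [OddOrth.vacuumDual_GammaPlus_ket _ (happ y x hy hx),
      OddOrth.soDet_append_eq_finsum lam y x hy hx]
    simp only [OddOrth.vacuumDual_GammaPlus_ket y hy]
  · have hs0 := OddOrth.weylDet_zero_left_ne_zero s t hs ht h
    rw [OddOrth.oddOrthChar_eq_soDet lam _ (happ s t hs ht) h]
    simp only [fun mu => OddOrth.oddOrthChar_eq_soDet mu s hs hs0]
    rw [← OddOrth.soDet_append_eq_finsum lam _ _ (fun i => pow_ne_zero 2 (hs i))
      fun i => pow_ne_zero 2 (ht i)]
    congr 2
    ext i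
    induction i using Fin.addCases <;> simp
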